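/- Let $\Bbbk$ be a field of characteristic $0$ (for instance $\mathbb C$), let $q\in\Bbbk^\times$ be not a root of unity (for instance $q=e^{\pi i/\varkappa}$ with $\varkappa\in\mathbb R\setminus\mathbb Q$), and fix a square root $q^{1/2}\in\Bbbk$ of $q$. **The quantum group.** $U_q(gl(2))$ is the algebra with generators $E,F,q^{\pm H},I$, where $I$ is central, $q^{H}q^{-H}=q^{-H}q^{H}=1$, $q^HE=q^2Eq^H$, $q^HF=q^{-2}Fq^H$ and $[E,F]=\frac{q^H-q^{-H}}{q-q^{-1}}$. For $\lambda\in\mathbb Z_{\ge0}$, $k\in\mathbb Z$, $V_{\lambda,k}$ is the irreducible representation of $U_q(gl(2))$ of dimension $\lambda+1$, with highest weight $\lambda$ (the highest weight vector is an eigenvector of $q^H$ with eigenvalue $q^\lambda$), on which $I$ acts by $k$; $\bar V_{\lambda,k}$ is the same representation with $q$ replaced by $q^{-1}$, a representation of $U_{q^{-1}}(gl(2))$. **The algebra.** $GL_q^+(2)$ is the algebra generated by $A,B,C,D$ with relations $$AB=q^{-1}BA,\quad CB=BC,\quad DB=qBD,\quad CA=qAC,\quad AD-DA=(q^{-1}-q)BC,\quad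 CD=q^{-1}DC .$$ It carries two commuting actions. In the first, $U_q(gl(2))$ acts by $E:A\mapsto B,\ C\mapsto D,\ B,D\mapsto0$; $F:B\mapsto A,\ D\mapsto C,\ A,C\mapsto 0$; $q^H$ is the algebra automorphism with $B\mapsto qB,\ D\mapsto qD,\ A\mapsto q^{-1}A,\ C\mapsto q^{-1}C$. In the second, $U_{q^{-1}}(gl(2))$, whose generators are denoted $\bar E,\bar F,\bar q^{\,\pm\bar H},\bar I$ with $\bar q=q^{-1}$, acts by $\bar E:C\mapsto A,\ D\mapsto B,\ A,B\mapsto0$; $\bar F:A\mapsto C,\ B\mapsto D,\ C,D\mapsto0$; $\bar q^{\,\bar H}$ is the algebra automorphism with $A\mapsto \bar qA,\ B\mapsto\bar qB,\ C\mapsto\bar q^{-1}C,\ D\mapsto\bar q^{-1}D$. The actions extend to products by $E(xy)=q^H(x)E(y)+E(x)y$ and $F(xy)=xF(y)+F(x)q^{-H}(y)$, and likewise for the barred generators with $\bar q^{\,\bar H}$ in place of $q^H$; both $I$ and $\bar I$ act as the derivation equal to the identity on $A,B,C,D$. The subspace $V_{\lambda,k}\otimes\bar V_{\lambda,k}$ of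 $GL_q^+(2)$ is the isotypic component of this type: the sum of all subrepresentations of $GL_q^+(2)$ under $U_q(gl(2))\otimes U_{q^{-1}}(gl(2))$ that are isomorphic to $V_{\lambda,k}\otimes\bar V_{\lambda,k}$. **The elements.** Extend $GL_q^+(2)$ by an invertible element $\delta$ with $\delta A=A\delta$, $\delta B=qB\delta$, $\delta C=q^{-1}C\delta$, $\delta D=D\delta$, and put $$x_{11}=\delta A,\quad x_{12}=q^{-1/2}\delta B,\quad x_{21}=q^{1/2}\delta C,\quad x_{22}=\delta D,\quad \det(x)=x_{11}x_{22}-x_{12}x_{21}.$$ For $\lambda,j\in\mathbb Z_{\ge0}$ and integers $r,k$ with $-\lambda\le r,k\le\lambda$ and $r\equiv k\equiv\lambda\pmod 2$ let $$X^\lambda_{rk}=\frac1{2\pi i}\oint (x_{11}s+x_{21})^{\frac{\lambda-r}2}(x_{12}s+x_{22})^{\frac{\lambda+r}2}s^{\frac{k-\lambda}2-1}\,ds,\qquad Y^{\lambda,j}_{r,k}=\delta^{-2j-\lambda}\det(x)^jX^\lambda_{rk},$$ where the integral around $0$ means the residue, i.e. the coefficient of $s^{-1}$ of the integrand as a Laurent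 polynomial in the central variable $s$. **Proposition.** The canonical map from $GL_q^+(2)$ to its extension by $\delta$ is injective. For all $\lambda,j\in\mathbb Z_{\ge0}$ the $(\lambda+1)^2$ elements $Y^{\lambda,j}_{r,k}$, indexed by the pairs $(r,k)$ above, lie in $GL_q^+(2)$ and form a basis of its subspace $V_{\lambda,\lambda+2j}\otimes\bar V_{\lambda,\lambda+2j}$. -/

import Mathlib

open scoped TensorProduct LaurentPolynomial

namespace QuantumGL

noncomputable section

variable {𝕜 : Type*} [Field 𝕜]

/-! ### The quantized enveloping algebra of `gl(2)` -/

/-- The generators of `U_q(gl(2))`; `K` stands for `q^H` and `Kinv` for `q^{-H}`. -/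
inductive UGen
  | E | F | K | Kinv | I

open FreeAlgebra in
/-- The defining relations of `U_q(gl(2))`. The relation `[E, F] = (q^H - q^{-H}) / (q - q⁻¹)` is
written without a denominator; the two forms agree as soon as `q ^ 2 ≠ 1`. -/
inductive URel (q : 𝕜ˣ) : FreeAlgebra 𝕜 UGen → FreeAlgebra 𝕜 UGen → Prop
  | K_Kinv : URel q (ι 𝕜 UGen.K * ι 𝕜 UGen.Kinv) 1
  | Kinv_K : URel q (ι 𝕜 UGen.Kinv * ι 𝕜 UGen.K) 1
  | K_E : URel q (ι 𝕜 UGen.K * ι 𝕜 UGen.E) (((q ^ 2 : 𝕜ˣ) : 𝕜) • (ι 𝕜 UGen.E * ι 𝕜 UGen.K))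
  | K_F : URel q (ι 𝕜 UGen.K * ι 𝕜 UGen.F) ((((q ^ 2)⁻¹ : 𝕜ˣ) : 𝕜) • (ι 𝕜 UGen.F * ι 𝕜 UGen.K))
  | E_F : URel q (((q : 𝕜) - ((q⁻¹ : 𝕜ˣ) : 𝕜)) •
      (ι 𝕜 UGen.E * ι 𝕜 UGen.F - ι 𝕜 UGen.F * ι 𝕜 UGen.E)) (ι 𝕜 UGen.K - ι 𝕜 UGen.Kinv)
  | I_central (g : UGen) : URel q (ι 𝕜 UGen.I * ι 𝕜 g) (ι 𝕜 g * ι 𝕜 UGen.I)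

/-- The algebra `U_q(gl(2))`. -/
def Uq (q : 𝕜ˣ) : Type _ := RingQuot (URel q)

instance (q : 𝕜ˣ) : Ring (Uq q) := inferInstanceAs (Ring (RingQuot (URel q)))
instance (q : 𝕜ˣ) : Algebra 𝕜 (Uq q) := inferInstanceAs (Algebra 𝕜 (RingQuot (URel q)))

/-- A family of elements of an algebra that satisfies the relations of `U_q(gl(2))`. -/
structure UData (q : 𝕜ˣ) (R : Type*) [Ring R] [Algebra 𝕜 R] where
  (E F K Kinv I : R)
  K_Kinv : K * Kinv = 1
  Kinv_K : Kinv * K = 1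
  K_E : K * E = ((q ^ 2 : 𝕜ˣ) : 𝕜) • (E * K)
  K_F : K * F = (((q ^ 2)⁻¹ : 𝕜ˣ) : 𝕜) • (F * K)
  E_F : ((q : 𝕜) - ((q⁻¹ : 𝕜ˣ) : 𝕜)) • (E * F - F * E) = K - Kinv
  I_E : I * E = E * I
  I_F : I * F = F * I
  I_K : I * K = K * I
  I_Kinv : I * Kinv = Kinv * I

/-- The image of a generator. -/
def UData.toFun {q : 𝕜ˣ} {R : Type*} [Ring R] [Algebra 𝕜 R] (d : UData q R) : UGen → R
  | .E => d.E
  | .F => d.F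
  | .K => d.K
  | .Kinv => d.Kinv
  | .I => d.I

/-- The generators of `U_q(gl(2))` as elements of the algebra. -/
def Uq.gen (q : 𝕜ˣ) (g : UGen) : Uq q := RingQuot.mkAlgHom 𝕜 (URel q) (FreeAlgebra.ι 𝕜 g)

/-- The algebra homomorphism out of `U_q(gl(2))` determined by the images of the generators. -/
def UData.lift {q : 𝕜ˣ} {R : Type*} [Ring R] [Algebra 𝕜 R] (d : UData q R) : Uq q →ₐ[𝕜] R :=
  RingQuot.liftAlgHom 𝕜 ⟨FreeAlgebra.lift 𝕜 d.toFun, by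
    intro x y h
    cases h with
    | K_Kinv => simpa [UData.toFun] using d.K_Kinv
    | Kinv_K => simpa [UData.toFun] using d.Kinv_K
    | K_E => simpa [UData.toFun] using d.K_E
    | K_F => simpa [UData.toFun] using d.K_F
    | E_F => simpa [UData.toFun] using d.E_F
    | I_central g =>
      cases g
      · simpa [UData.toFun] using d.I_E
      · simpa [UData.toFun] using d.I_F
      · simpa [UData.toFun] using d.I_K
      · simpa [UData.toFun] using d.I_Kinv
      · simp [UData.toFun]⟩

theorem UData.lift_gen {q : 𝕜ˣ} {R : Type*} [Ring R] [Algebra 𝕜 R] (d : UData q R) (g : UGen) :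
    d.lift (Uq.gen q g) = d.toFun g := by
  unfold UData.lift Uq.gen
  exact (RingQuot.liftAlgHom_mkAlgHom_apply _ _ _ _).trans (by simp)

theorem adjoin_ringQuot {X : Type*} (r : FreeAlgebra 𝕜 X → FreeAlgebra 𝕜 X → Prop) :
    Algebra.adjoin 𝕜 (Set.range fun g => RingQuot.mkAlgHom 𝕜 r (FreeAlgebra.ι 𝕜 g)) = ⊤ := by
  have h1 : (RingQuot.mkAlgHom 𝕜 r).range = ⊤ :=
    (AlgHom.range_eq_top _).2 (RingQuot.mkAlgHom_surjective 𝕜 r)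
  have h2 : (Set.range fun g => RingQuot.mkAlgHom 𝕜 r (FreeAlgebra.ι 𝕜 g))
      = RingQuot.mkAlgHom 𝕜 r '' Set.range (FreeAlgebra.ι 𝕜) := by
    rw [← Set.range_comp]; rfl
  rw [h2, ← AlgHom.map_adjoin, FreeAlgebra.adjoin_range_ι, Algebra.map_top, h1]

theorem Uq.adjoin_gen (q : 𝕜ˣ) : Algebra.adjoin 𝕜 (Set.range (Uq.gen q)) = ⊤ :=
  adjoin_ringQuot (URel q)

/-! ### The irreducible representations -/

/-- The quantum integer `[n] = (q^n - q^{-n}) / (q - q⁻¹)`. -/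
def qInt (q : 𝕜ˣ) (n : ℤ) : 𝕜 :=
  (((q ^ n : 𝕜ˣ) : 𝕜) - ((q ^ (-n) : 𝕜ˣ) : 𝕜)) / ((q : 𝕜) - ((q⁻¹ : 𝕜ˣ) : 𝕜))

/-- The space of the representation `V_{l,k}`, with basis `v₀, …, v_l`. -/
def Vrep (_q : 𝕜ˣ) (l : ℕ) (_k : ℤ) : Type _ := Fin (l + 1) → 𝕜

instance (q : 𝕜ˣ) (l : ℕ) (k : ℤ) : AddCommGroup (Vrep q l k) :=
  inferInstanceAs (AddCommGroup (Fin (l + 1) → 𝕜))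
instance (q : 𝕜ˣ) (l : ℕ) (k : ℤ) : Module 𝕜 (Vrep q l k) :=
  inferInstanceAs (Module 𝕜 (Fin (l + 1) → 𝕜))

namespace Vrep

variable (q : 𝕜ˣ) (l : ℕ) (k : ℤ)

theorem add_apply (v w : Vrep q l k) (i : Fin (l + 1)) : (v + w) i = v i + w i := rfl
theorem sub_apply (v w : Vrep q l k) (i : Fin (l + 1)) : (v - w) i = v i - w i := rfl
theorem smul_apply (c : 𝕜) (v : Vrep q l k) (i : Fin (l + 1)) : (c • v) i = c * v i := rfl

variable {q l k} in
theorem ext {v w : Vrep q l k} (h : ∀ i, v i = w i) : v = w := funext h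

/-- `E v_{i+1} = [l - i] v_i` and `E v₀ = 0`. -/
def funE (v : Vrep q l k) : Vrep q l k :=
  fun i => if h : i.1 + 1 < l + 1 then qInt q (l - i.1) * v ⟨i.1 + 1, h⟩ else 0

/-- The operator `E`. -/
def opE : Vrep q l k →ₗ[𝕜] Vrep q l k where
  toFun := funE q l k
  map_add' v w := by
    refine Vrep.ext fun i => ?_
    simp only [add_apply, funE]
    split_ifs
    · exact mul_add _ _ _
    · simp
  map_smul' c v := by
    refine Vrep.ext fun i => ?_
    simp only [smul_apply, RingHom.id_apply, funE]
    split_ifs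
    · exact mul_left_comm _ _ _
    · simp

/-- `F v_i = [i + 1] v_{i+1}` and `F v_l = 0`. -/
def funF (v : Vrep q l k) : Vrep q l k :=
  fun i => if 0 < i.1 then qInt q i.1 * v ⟨i.1 - 1, by omega⟩ else 0

/-- The operator `F`. -/
def opF : Vrep q l k →ₗ[𝕜] Vrep q l k where
  toFun := funF q l k
  map_add' v w := by
    refine Vrep.ext fun i => ?_
    simp only [add_apply, funF]
    split_ifs
    · exact mul_add _ _ _
    · simp
  map_smul' c v := by
    refine Vrep.ext fun i => ?_
    simp only [smul_apply, RingHom.id_apply, funF]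
    split_ifs
    · exact mul_left_comm _ _ _
    · simp

/-- `u^H v_i = u^{l - 2 i} v_i`; for `u = q` this is `q^H`. -/
def opK (u : 𝕜ˣ) : Vrep q l k →ₗ[𝕜] Vrep q l k where
  toFun v := fun i => ((u ^ ((l : ℤ) - 2 * i.1) : 𝕜ˣ) : 𝕜) * v i
  map_add' v w := by funext i; exact mul_add _ _ _
  map_smul' c v := by funext i; exact mul_left_comm _ _ _

theorem opE_apply (v : Vrep q l k) (i : Fin (l + 1)) : opE q l k v i =
    if h : i.1 + 1 < l + 1 then qInt q (l - i.1) * v ⟨i.1 + 1, h⟩ else 0 := rfl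
theorem opF_apply (v : Vrep q l k) (i : Fin (l + 1)) : opF q l k v i =
    if 0 < i.1 then qInt q i.1 * v ⟨i.1 - 1, by omega⟩ else 0 := rfl
theorem opK_apply (u : 𝕜ˣ) (v : Vrep q l k) (i : Fin (l + 1)) : opK q l k u v i =
    ((u ^ ((l : ℤ) - 2 * i.1) : 𝕜ˣ) : 𝕜) * v i := rfl

variable {q} in
theorem qInt_identity (a b : ℤ) : ((q : 𝕜) - ((q⁻¹ : 𝕜ˣ) : 𝕜)) *
    (qInt q (a + 1) * qInt q b - qInt q a * qInt q (b + 1)) =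
    ((q ^ (b - a) : 𝕜ˣ) : 𝕜) - ((q⁻¹ ^ (b - a) : 𝕜ˣ) : 𝕜) := by
  have hq : (q : 𝕜) ≠ 0 := q.ne_zero
  by_cases h : (q : 𝕜) - ((q⁻¹ : 𝕜ˣ) : 𝕜) = 0
  · have : q = q⁻¹ := by ext; exact sub_eq_zero.1 h
    rw [← this]; simp
  · unfold qInt
    simp only [Units.val_inv_eq_inv_val, Units.val_zpow_eq_zpow_val] at h ⊢
    rw [show a + 1 = 1 + a by ring, show b + 1 = 1 + b by ring]
    simp only [zpow_add₀ hq, zpow_sub₀ hq, zpow_neg, zpow_one, inv_zpow]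
    have ha : (q : 𝕜) ^ a ≠ 0 := zpow_ne_zero _ hq
    have hb : (q : 𝕜) ^ b ≠ 0 := zpow_ne_zero _ hq
    generalize (q : 𝕜) ^ a = x at *
    generalize (q : 𝕜) ^ b = y at *
    generalize (q : 𝕜) = z at *
    have h' : z ^ 2 - 1 ≠ 0 := by
      intro h'
      apply h
      field_simp
      linear_combination h'
    have h2 : z - z⁻¹ = (z ^ 2 - 1) / z := by field_simp
    rw [h2]
    field_simp
    ring

/-- The relations of `U_q(gl(2))` on `V_{l,k}`; the central element `I` acts by `k`. -/
def data : UData q (Module.End 𝕜 (Vrep q l k)) where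
  E := opE q l k
  F := opF q l k
  K := opK q l k q
  Kinv := opK q l k q⁻¹
  I := (k : 𝕜) • LinearMap.id
  K_Kinv := by
    refine LinearMap.ext fun v => Vrep.ext fun i => ?_
    simp only [Module.End.mul_apply, Module.End.one_apply, opK_apply, inv_zpow, ← mul_assoc,
      ← Units.val_mul]
    simp
  Kinv_K := by
    refine LinearMap.ext fun v => Vrep.ext fun i => ?_
    simp only [Module.End.mul_apply, Module.End.one_apply, opK_apply, inv_zpow, ← mul_assoc,
      ← Units.val_mul]
    simp
  K_E := by
    refine LinearMap.ext fun v => Vrep.ext fun i => ?_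
    simp only [Module.End.mul_apply, LinearMap.smul_apply, smul_apply, opK_apply, opE_apply]
    split_ifs
    · rw [show (l : ℤ) - 2 * (i.1 : ℤ) = 2 + (l - 2 * ((i.1 + 1 : ℕ) : ℤ)) by push_cast; ring,
        zpow_add]
      push_cast
      simp only [zpow_ofNat]
      ring
    · simp
  K_F := by
    refine LinearMap.ext fun v => Vrep.ext fun i => ?_
    simp only [Module.End.mul_apply, LinearMap.smul_apply, smul_apply, opK_apply, opF_apply]
    split_ifs with h
    · rw [show (l : ℤ) - 2 * (i.1 : ℤ) = -2 + (l - 2 * ((i.1 - 1 : ℕ) : ℤ)) by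
        push_cast [Nat.cast_sub (show 1 ≤ i.1 from h)]; ring, zpow_add]
      rw [show q ^ (-2 : ℤ) = (q ^ 2)⁻¹ from rfl]
      push_cast
      ring
    · simp
  E_F := by
    refine LinearMap.ext fun v => Vrep.ext fun i => ?_
    simp only [Module.End.mul_apply, LinearMap.smul_apply, smul_apply, LinearMap.sub_apply,
      sub_apply, opK_apply, opE_apply, opF_apply]
    have h1 : (if h : i.1 + 1 < l + 1 then qInt q (l - i.1) *
        (if 0 < i.1 + 1 then qInt q ((i.1 + 1 : ℕ) : ℤ) * v ⟨i.1 + 1 - 1, by omega⟩ else 0) else 0)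
        = qInt q (l - i.1) * qInt q (i.1 + 1) * v i := by
      split_ifs with h h'
      · simp [mul_assoc]
      · omega
      · have : (l : ℤ) - i.1 = 0 := by omega
        simp [this, qInt]
    have h2 : (if 0 < i.1 then qInt q i.1 * (if h : i.1 - 1 + 1 < l + 1 then
        qInt q (l - ((i.1 - 1 : ℕ) : ℤ)) * v ⟨i.1 - 1 + 1, h⟩ else 0) else 0)
        = qInt q i.1 * qInt q (l - i.1 + 1) * v i := by
      split_ifs with h h'
      · have e : (⟨i.1 - 1 + 1, h'⟩ : Fin (l + 1)) = i := by ext; simp; omega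
        rw [e, show (l : ℤ) - ((i.1 - 1 : ℕ) : ℤ) = l - i.1 + 1 by
          push_cast [Nat.cast_sub (show 1 ≤ i.1 from h)]; ring, mul_assoc]
      · omega
      · have : (i.1 : ℤ) = 0 := by omega
        simp [this, qInt]
    rw [h1, h2]
    have := qInt_identity (q := q) (i.1 : ℤ) (l - i.1)
    rw [show (l : ℤ) - i.1 - i.1 = l - 2 * i.1 by ring] at this
    linear_combination (v i) * this
  I_E := by
    ext v; simp [Module.End.mul_apply]
  I_F := by
    ext v; simp [Module.End.mul_apply]
  I_K := by
    ext v; simp [Module.End.mul_apply]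
  I_Kinv := by
    ext v; simp [Module.End.mul_apply]

end Vrep

/-! ### The algebra `GL_q^+(2)` -/

/-- The generators of the quantum matrix algebra. -/
inductive MatGen
  | A | B | C | D

open FreeAlgebra in
/-- The defining relations of `GL_q^+(2)`. -/
inductive MatRel (q : 𝕜ˣ) : FreeAlgebra 𝕜 MatGen → FreeAlgebra 𝕜 MatGen → Prop
  | A_B : MatRel q (ι 𝕜 MatGen.A * ι 𝕜 MatGen.B)
      (((q⁻¹ : 𝕜ˣ) : 𝕜) • (ι 𝕜 MatGen.B * ι 𝕜 MatGen.A))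
  | C_B : MatRel q (ι 𝕜 MatGen.C * ι 𝕜 MatGen.B) (ι 𝕜 MatGen.B * ι 𝕜 MatGen.C)
  | D_B : MatRel q (ι 𝕜 MatGen.D * ι 𝕜 MatGen.B) ((q : 𝕜) • (ι 𝕜 MatGen.B * ι 𝕜 MatGen.D))
  | C_A : MatRel q (ι 𝕜 MatGen.C * ι 𝕜 MatGen.A) ((q : 𝕜) • (ι 𝕜 MatGen.A * ι 𝕜 MatGen.C))
  | A_D : MatRel q (ι 𝕜 MatGen.A * ι 𝕜 MatGen.D - ι 𝕜 MatGen.D * ι 𝕜 MatGen.A)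
      ((((q⁻¹ : 𝕜ˣ) : 𝕜) - (q : 𝕜)) • (ι 𝕜 MatGen.B * ι 𝕜 MatGen.C))
  | C_D : MatRel q (ι 𝕜 MatGen.C * ι 𝕜 MatGen.D)
      (((q⁻¹ : 𝕜ˣ) : 𝕜) • (ι 𝕜 MatGen.D * ι 𝕜 MatGen.C))

/-- The algebra `GL_q^+(2)`, generated by `A, B, C, D`. -/
def GLqPlus (q : 𝕜ˣ) : Type _ := RingQuot (MatRel q)

instance (q : 𝕜ˣ) : Ring (GLqPlus q) := inferInstanceAs (Ring (RingQuot (MatRel q)))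
instance (q : 𝕜ˣ) : Algebra 𝕜 (GLqPlus q) := inferInstanceAs (Algebra 𝕜 (RingQuot (MatRel q)))

/-- Four elements of an algebra that satisfy the relations of `GL_q^+(2)`. -/
structure MatData (q : 𝕜ˣ) (R : Type*) [Ring R] [Algebra 𝕜 R] where
  (A B C D : R)
  A_B : A * B = ((q⁻¹ : 𝕜ˣ) : 𝕜) • (B * A)
  C_B : C * B = B * C
  D_B : D * B = (q : 𝕜) • (B * D)
  C_A : C * A = (q : 𝕜) • (A * C)
  A_D : A * D - D * A = (((q⁻¹ : 𝕜ˣ) : 𝕜) - (q : 𝕜)) • (B * C)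
  C_D : C * D = ((q⁻¹ : 𝕜ˣ) : 𝕜) • (D * C)

/-- The image of a generator. -/
def MatData.toFun {q : 𝕜ˣ} {R : Type*} [Ring R] [Algebra 𝕜 R] (d : MatData q R) : MatGen → R
  | .A => d.A
  | .B => d.B
  | .C => d.C
  | .D => d.D

/-- The algebra homomorphism out of `GL_q^+(2)` determined by the images of the generators. -/
def MatData.lift {q : 𝕜ˣ} {R : Type*} [Ring R] [Algebra 𝕜 R] (d : MatData q R) :
    GLqPlus q →ₐ[𝕜] R :=
  RingQuot.liftAlgHom 𝕜 ⟨FreeAlgebra.lift 𝕜 d.toFun, by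
    intro x y h
    cases h with
    | A_B => simpa [MatData.toFun] using d.A_B
    | C_B => simpa [MatData.toFun] using d.C_B
    | D_B => simpa [MatData.toFun] using d.D_B
    | C_A => simpa [MatData.toFun] using d.C_A
    | A_D => simpa [MatData.toFun] using d.A_D
    | C_D => simpa [MatData.toFun] using d.C_D⟩

namespace GLqPlus

variable (q : 𝕜ˣ)

/-- The generators `A, B, C, D` as elements of the algebra. -/
def gen (g : MatGen) : GLqPlus q := RingQuot.mkAlgHom 𝕜 (MatRel q) (FreeAlgebra.ι 𝕜 g)

theorem adjoin_gen : Algebra.adjoin 𝕜 (Set.range (gen q)) = ⊤ := adjoin_ringQuot (MatRel q)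

theorem lift_gen {q : 𝕜ˣ} {R : Type*} [Ring R] [Algebra 𝕜 R] (d : MatData q R) (g : MatGen) :
    d.lift (gen q g) = d.toFun g := by
  unfold MatData.lift gen
  exact (RingQuot.liftAlgHom_mkAlgHom_apply _ _ _ _).trans (by simp)

/-- The generators satisfy the relations. -/
def genData : MatData q (GLqPlus q) where
  A := gen q .A
  B := gen q .B
  C := gen q .C
  D := gen q .D
  A_B := by
    have h := RingQuot.mkAlgHom_rel 𝕜 (MatRel.A_B (q := q))
    rw [map_smul, map_mul, map_mul] at h
    exact h
  C_B := by
    have h := RingQuot.mkAlgHom_rel 𝕜 (MatRel.C_B (q := q))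
    rw [map_mul, map_mul] at h
    exact h
  D_B := by
    have h := RingQuot.mkAlgHom_rel 𝕜 (MatRel.D_B (q := q))
    rw [map_smul, map_mul, map_mul] at h
    exact h
  C_A := by
    have h := RingQuot.mkAlgHom_rel 𝕜 (MatRel.C_A (q := q))
    rw [map_smul, map_mul, map_mul] at h
    exact h
  A_D := by
    have h := RingQuot.mkAlgHom_rel 𝕜 (MatRel.A_D (q := q))
    rw [map_sub, map_smul, map_mul, map_mul, map_mul] at h
    exact h
  C_D := by
    have h := RingQuot.mkAlgHom_rel 𝕜 (MatRel.C_D (q := q))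
    rw [map_smul, map_mul, map_mul] at h
    exact h

theorem induction {q : 𝕜ˣ} {P : GLqPlus q → Prop} (x : GLqPlus q)
    (hg : ∀ g, P (gen q g)) (hc : ∀ c : 𝕜, P (algebraMap 𝕜 _ c))
    (ha : ∀ x y, P x → P y → P (x + y)) (hm : ∀ x y, P x → P y → P (x * y)) : P x := by
  have hx : x ∈ Algebra.adjoin 𝕜 (Set.range (gen q)) := by rw [adjoin_gen]; trivial
  induction hx using Algebra.adjoin_induction with
  | mem x hx => obtain ⟨g, rfl⟩ := hx; exact hg g
  | algebraMap c => exact hc c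
  | add x y _ _ h1 h2 => exact ha x y h1 h2
  | mul x y _ _ h1 h2 => exact hm x y h1 h2

/-- Normal ordering of products of two generators. -/
theorem BA : gen q .B * gen q .A = (q : 𝕜) • (gen q .A * gen q .B) := by
  have := (genData q).A_B
  simp only [genData] at this
  rw [this, smul_smul]
  simp
theorem CB : gen q .C * gen q .B = gen q .B * gen q .C := (genData q).C_B
theorem DB : gen q .D * gen q .B = (q : 𝕜) • (gen q .B * gen q .D) := (genData q).D_B
theorem CA : gen q .C * gen q .A = (q : 𝕜) • (gen q .A * gen q .C) := (genData q).C_A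
theorem DC : gen q .D * gen q .C = (q : 𝕜) • (gen q .C * gen q .D) := by
  have := (genData q).C_D
  simp only [genData] at this
  rw [this, smul_smul]
  simp
theorem DA : gen q .D * gen q .A = gen q .A * gen q .D
    - (((q⁻¹ : 𝕜ˣ) : 𝕜) - (q : 𝕜)) • (gen q .B * gen q .C) := by
  have := (genData q).A_D
  simp only [genData] at this
  rw [← this]
  abel

/-- The weights of the generators for the torus `(u, w)`: a generator `a_± ⊗ ā_±` is scaled by
`u` or `u⁻¹` and by `w` or `w⁻¹`, where `A = a₋ ⊗ ā₊`, `B = a₊ ⊗ ā₊`, `C = a₋ ⊗ ā₋`,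
`D = a₊ ⊗ ā₋`. -/
def weight (u w : 𝕜ˣ) : MatGen → 𝕜ˣ
  | .A => u⁻¹ * w
  | .B => u * w
  | .C => u⁻¹ * w⁻¹
  | .D => u * w⁻¹

/-- The automorphism of `GL_q^+(2)` that scales the generators by their weights. -/
def torus (u w : 𝕜ˣ) : GLqPlus q →ₐ[𝕜] GLqPlus q :=
  MatData.lift
    { A := (weight u w .A : 𝕜) • gen q .A
      B := (weight u w .B : 𝕜) • gen q .B
      C := (weight u w .C : 𝕜) • gen q .C
      D := (weight u w .D : 𝕜) • gen q .D
      A_B := by simp only [smul_mul_smul_comm, BA, smul_smul]; congr 1; simp; field_simp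
      C_B := by simp only [smul_mul_smul_comm, CB]; congr 1; ring
      D_B := by simp only [smul_mul_smul_comm, DB, smul_smul]; congr 1; ring
      C_A := by simp only [smul_mul_smul_comm, CA, smul_smul]; congr 1; ring
      A_D := by
        have h1 : (weight u w .A : 𝕜) * weight u w .D = 1 := by
          simp [weight]; field_simp
        have h2 : (weight u w .D : 𝕜) * weight u w .A = 1 := by
          simp [weight]; field_simp
        have h3 : (weight u w .B : 𝕜) * weight u w .C = 1 := by
          simp [weight]; field_simp
        simp only [smul_mul_smul_comm, h1, h2, h3, one_smul, DA]
        abel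
      C_D := by simp only [smul_mul_smul_comm, DC, smul_smul]; congr 1; simp; field_simp }

theorem torus_gen (u w : 𝕜ˣ) (g : MatGen) :
    torus q u w (gen q g) = (weight u w g : 𝕜) • gen q g := by
  rw [torus, lift_gen]
  cases g <;> rfl

theorem weight_mul (u w u' w' : 𝕜ˣ) (g : MatGen) :
    weight (u * u') (w * w') g = weight u w g * weight u' w' g := by
  cases g <;> simp only [weight, mul_inv] <;> exact mul_mul_mul_comm _ _ _ _

theorem torus_torus (u w u' w' : 𝕜ˣ) (x : GLqPlus q) :
    torus q u w (torus q u' w' x) = torus q (u * u') (w * w') x := by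
  induction x using induction with
  | hg g => simp only [torus_gen, map_smul, smul_smul, weight_mul, Units.val_mul, mul_comm]
  | hc c => simp
  | ha x y h1 h2 => simp only [map_add, h1, h2]
  | hm x y h1 h2 => simp only [map_mul, h1, h2]

theorem torus_one (x : GLqPlus q) : torus q 1 1 x = x := by
  induction x using induction with
  | hg g => rw [torus_gen]; cases g <;> simp [weight]
  | hc c => simp
  | ha x y h1 h2 => simp only [map_add, h1, h2]
  | hm x y h1 h2 => simp only [map_mul, h1, h2]

/-! ### Skew derivations of `GL_q^+(2)` -/

/-- Values on the generators that extend to an `(f, g)`-skew derivation, that is, to a linear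
map `d` with `d (x * y) = f x * d y + d x * g y`. -/
structure SkewData (f g : GLqPlus q →ₐ[𝕜] GLqPlus q) where
  (A B C D : GLqPlus q)
  A_B : f (gen q .A) * B + A * g (gen q .B) =
    ((q⁻¹ : 𝕜ˣ) : 𝕜) • (f (gen q .B) * A + B * g (gen q .A))
  C_B : f (gen q .C) * B + C * g (gen q .B) = f (gen q .B) * C + B * g (gen q .C)
  D_B : f (gen q .D) * B + D * g (gen q .B) = (q : 𝕜) • (f (gen q .B) * D + B * g (gen q .D))
  C_A : f (gen q .C) * A + C * g (gen q .A) = (q : 𝕜) • (f (gen q .A) * C + A * g (gen q .C))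
  A_D : f (gen q .A) * D + A * g (gen q .D) - (f (gen q .D) * A + D * g (gen q .A)) =
    (((q⁻¹ : 𝕜ˣ) : 𝕜) - (q : 𝕜)) • (f (gen q .B) * C + B * g (gen q .C))
  C_D : f (gen q .C) * D + C * g (gen q .D) =
    ((q⁻¹ : 𝕜ˣ) : 𝕜) • (f (gen q .D) * C + D * g (gen q .C))

variable {q}
variable {f g : GLqPlus q →ₐ[𝕜] GLqPlus q}

/-- The value on a generator. -/
def SkewData.toFun (d : SkewData q f g) : MatGen → GLqPlus q
  | .A => d.A
  | .B => d.B
  | .C => d.C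
  | .D => d.D

theorem rel_aux (x y : MatGen) (a b : GLqPlus q) :
    (!![f (gen q x), a; 0, g (gen q x)] * !![f (gen q y), b; 0, g (gen q y)] :
      Matrix (Fin 2) (Fin 2) (GLqPlus q)) =
    !![f (gen q x * gen q y), f (gen q x) * b + a * g (gen q y); 0, g (gen q x * gen q y)] := by
  simp

/-- The homomorphism `x ↦ [[f x, d x], [0, g x]]` for a skew derivation `d`. -/
def SkewData.matrixHom (d : SkewData q f g) :
    GLqPlus q →ₐ[𝕜] Matrix (Fin 2) (Fin 2) (GLqPlus q) :=
  MatData.lift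
    { A := !![f (gen q .A), d.A; 0, g (gen q .A)]
      B := !![f (gen q .B), d.B; 0, g (gen q .B)]
      C := !![f (gen q .C), d.C; 0, g (gen q .C)]
      D := !![f (gen q .D), d.D; 0, g (gen q .D)]
      A_B := by
        have h := (genData q).A_B
        simp only [genData] at h
        rw [rel_aux, rel_aux, d.A_B, h]
        ext i j; fin_cases i <;> fin_cases j <;> simp
      C_B := by
        have h := (genData q).C_B
        simp only [genData] at h
        rw [rel_aux, rel_aux, d.C_B, h]
      D_B := by
        have h := (genData q).D_B
        simp only [genData] at h
        rw [rel_aux, rel_aux, d.D_B, h]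
        ext i j; fin_cases i <;> fin_cases j <;> simp
      C_A := by
        have h := (genData q).C_A
        simp only [genData] at h
        rw [rel_aux, rel_aux, d.C_A, h]
        ext i j; fin_cases i <;> fin_cases j <;> simp
      A_D := by
        have h := (genData q).A_D
        simp only [genData] at h
        rw [rel_aux, rel_aux, rel_aux]
        ext i j; fin_cases i <;> fin_cases j
        · simpa using congrArg f h
        · simpa using d.A_D
        · simp
        · simpa using congrArg g h
      C_D := by
        have h := (genData q).C_D
        simp only [genData] at h
        rw [rel_aux, rel_aux, d.C_D, h]
        ext i j; fin_cases i <;> fin_cases j <;> simp }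

/-- The skew derivation determined by its values on the generators. -/
def SkewData.der (d : SkewData q f g) : GLqPlus q →ₗ[𝕜] GLqPlus q where
  toFun x := d.matrixHom x 0 1
  map_add' x y := by simp
  map_smul' c x := by simp

theorem SkewData.der_apply (d : SkewData q f g) (x : GLqPlus q) : d.der x = d.matrixHom x 0 1 := rfl

theorem SkewData.matrixHom_apply (d : SkewData q f g) (x : GLqPlus q) :
    d.matrixHom x = !![f x, d.der x; 0, g x] := by
  induction x using induction with
  | hg x =>
    have h : d.matrixHom (gen q x) = !![f (gen q x), d.toFun x; 0, g (gen q x)] := by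
      rw [SkewData.matrixHom, lift_gen]
      cases x <;> rfl
    rw [der_apply, h]
    simp
  | hc c =>
    rw [der_apply]
    ext i j
    fin_cases i <;> fin_cases j <;> simp [Matrix.algebraMap_matrix_apply]
  | ha x y h1 h2 =>
    rw [map_add, h1, h2]
    ext i j
    fin_cases i <;> fin_cases j <;> simp
  | hm x y h1 h2 =>
    rw [der_apply, map_mul, h1, h2]
    simp

theorem SkewData.der_gen (d : SkewData q f g) (x : MatGen) : d.der (gen q x) = d.toFun x := by
  rw [der_apply, SkewData.matrixHom, lift_gen]
  cases x <;> rfl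

/-- The skew Leibniz rule. -/
theorem SkewData.der_mul (d : SkewData q f g) (x y : GLqPlus q) :
    d.der (x * y) = f x * d.der y + d.der x * g y := by
  rw [der_apply, map_mul, matrixHom_apply, matrixHom_apply]
  simp

theorem SkewData.der_algebraMap (d : SkewData q f g) (c : 𝕜) :
    d.der (algebraMap 𝕜 _ c) = 0 := by
  rw [der_apply]
  simp [Matrix.algebraMap_matrix_apply]

/-- Two skew derivations commute if they commute on the generators and the automorphisms involved
commute with everything. -/
theorem SkewData.comm {f' g' : GLqPlus q →ₐ[𝕜] GLqPlus q} (d : SkewData q f g)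
    (d' : SkewData q f' g')
    (hff : ∀ x, f (f' x) = f' (f x)) (hgg : ∀ x, g (g' x) = g' (g x))
    (hfd : ∀ x, f (d'.der x) = d'.der (f x)) (hgd : ∀ x, g (d'.der x) = d'.der (g x))
    (hdf : ∀ x, d.der (f' x) = f' (d.der x)) (hdg : ∀ x, d.der (g' x) = g' (d.der x))
    (h : ∀ x, d.der (d'.der (gen q x)) = d'.der (d.der (gen q x))) (x : GLqPlus q) :
    d.der (d'.der x) = d'.der (d.der x) := by
  induction x using induction with
  | hg x => exact h x
  | hc c => simp [der_algebraMap]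
  | ha x y h1 h2 => simp only [map_add, h1, h2]
  | hm x y h1 h2 =>
    simp only [der_mul, map_add, hff, hgg, hfd, hgd, hdf, hdg, h1, h2]
    abel

/-- A torus automorphism commutes with a skew derivation up to a scalar if it does so on the
generators. -/
theorem SkewData.torus_comm (d : SkewData q f g) (u w : 𝕜ˣ) (c : 𝕜)
    (hf : ∀ x, torus q u w (f x) = f (torus q u w x))
    (hg : ∀ x, torus q u w (g x) = g (torus q u w x))
    (h : ∀ x, torus q u w (d.der (gen q x)) = c • d.der (torus q u w (gen q x)))
    (x : GLqPlus q) : torus q u w (d.der x) = c • d.der (torus q u w x) := by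
  induction x using induction with
  | hg x => exact h x
  | hc a => simp [der_algebraMap]
  | ha x y h1 h2 => simp only [map_add, h1, h2, smul_add]
  | hm x y h1 h2 =>
    simp only [der_mul, map_add, map_mul, hf, hg, h1, h2, smul_add, mul_smul_comm, smul_mul_assoc]

/-! ### The two actions on `GL_q^+(2)` -/

theorem torus_comm_torus (u w u' w' : 𝕜ˣ) (x : GLqPlus q) :
    torus q u w (torus q u' w' x) = torus q u' w' (torus q u w x) := by
  rw [torus_torus, torus_torus, mul_comm u, mul_comm w]

variable (q)

/-- The element `I`: the derivation with eigenvalue `1` on the generators. -/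
def degData : SkewData q (AlgHom.id 𝕜 _) (AlgHom.id 𝕜 _) where
  A := gen q .A
  B := gen q .B
  C := gen q .C
  D := gen q .D
  A_B := by simp only [AlgHom.id_apply, BA]; simp
  C_B := by simp only [AlgHom.id_apply, CB]
  D_B := by simp only [AlgHom.id_apply, DB]; module
  C_A := by simp only [AlgHom.id_apply, CA]; module
  A_D := by simp only [AlgHom.id_apply, DA]; module
  C_D := by simp only [AlgHom.id_apply, DC]; simp

/-- `E` of the first action: `A ↦ B`, `C ↦ D`, `B, D ↦ 0` and
`E (x y) = q^H(x) E(y) + E(x) y`. -/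
def leftEData : SkewData q (torus q q 1) (AlgHom.id 𝕜 _) where
  A := gen q .B
  B := 0
  C := gen q .D
  D := 0
  A_B := by simp [torus_gen, weight, smul_smul]
  C_B := by simp [torus_gen, weight, DB]
  D_B := by simp
  C_A := by
    simp [torus_gen, weight, DA, CB]
    match_scalars <;> field_simp
    ring
  A_D := by
    simp [torus_gen, weight, DB]
    match_scalars
    field_simp
  C_D := by simp [torus_gen, weight, smul_smul]

/-- `F` of the first action: `B ↦ A`, `D ↦ C`, `A, C ↦ 0` and
`F (x y) = x F(y) + F(x) q^{-H}(y)`. -/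
def leftFData : SkewData q (AlgHom.id 𝕜 _) (torus q q⁻¹ 1) where
  A := 0
  B := gen q .A
  C := 0
  D := gen q .C
  A_B := by simp [torus_gen, weight, smul_smul]
  C_B := by simp [torus_gen, weight, CA]
  D_B := by
    simp [torus_gen, weight, DA, CB, smul_smul]
    match_scalars <;> field_simp
    ring
  C_A := by simp
  A_D := by
    simp [torus_gen, weight, CA, smul_smul]
    match_scalars
    field_simp
  C_D := by simp [torus_gen, weight, smul_smul]

/-- `E` of the second action: `C ↦ A`, `D ↦ B`, `A, B ↦ 0`, with the rule of the first action
for `q⁻¹`. -/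
def rightEData : SkewData q (torus q 1 q⁻¹) (AlgHom.id 𝕜 _) where
  A := 0
  B := 0
  C := gen q .A
  D := gen q .B
  A_B := by simp
  C_B := by simp [torus_gen, weight, BA, smul_smul]
  D_B := by simp [torus_gen, weight, smul_smul]
  C_A := by simp [torus_gen, weight, smul_smul]
  A_D := by
    simp [torus_gen, weight, BA]
    module
  C_D := by
    simp [torus_gen, weight, CB, DA]
    module

/-- `F` of the second action: `A ↦ C`, `B ↦ D`, `C, D ↦ 0`, with the rule of the first action
for `q⁻¹`. -/
def rightFData : SkewData q (AlgHom.id 𝕜 _) (torus q 1 q) where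
  A := gen q .C
  B := gen q .D
  C := 0
  D := 0
  A_B := by
    simp [torus_gen, weight, CB, DA]
    module
  C_B := by simp [torus_gen, weight, DC, smul_smul]
  D_B := by simp [torus_gen, weight, smul_smul]
  C_A := by simp [torus_gen, weight, smul_smul]
  A_D := by
    simp [torus_gen, weight, DC, smul_smul]
    module
  C_D := by simp

variable {q}

theorem deg_torus (u w : 𝕜ˣ) (x : GLqPlus q) :
    (degData q).der (torus q u w x) = torus q u w ((degData q).der x) := by
  refine ((SkewData.torus_comm (degData q) u w 1 (fun _ => rfl) (fun _ => rfl) ?_ x).trans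
    (one_smul _ _)).symm
  intro g
  simp only [torus_gen, SkewData.der_gen, map_smul, one_smul]
  cases g <;> simp [SkewData.toFun, degData, torus_gen]

theorem torus_leftE (u w : 𝕜ˣ) (x : GLqPlus q) : torus q u w ((leftEData q).der x) =
    ((u ^ 2 : 𝕜ˣ) : 𝕜) • (leftEData q).der (torus q u w x) := by
  refine SkewData.torus_comm (leftEData q) u w ((u ^ 2 : 𝕜ˣ) : 𝕜)
    (torus_comm_torus u w q 1) (fun y => by rw [AlgHom.id_apply, AlgHom.id_apply]) ?_ x
  intro g
  simp only [torus_gen, SkewData.der_gen, map_smul]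
  cases g <;> simp [SkewData.toFun, leftEData, torus_gen, weight, smul_smul] <;> match_scalars <;>
    field_simp

theorem torus_leftF (u w : 𝕜ˣ) (x : GLqPlus q) : torus q u w ((leftFData q).der x) =
    (((u ^ 2)⁻¹ : 𝕜ˣ) : 𝕜) • (leftFData q).der (torus q u w x) := by
  refine SkewData.torus_comm (leftFData q) u w (((u ^ 2)⁻¹ : 𝕜ˣ) : 𝕜)
    (fun y => by rw [AlgHom.id_apply, AlgHom.id_apply]) (torus_comm_torus u w q⁻¹ 1) ?_ x
  intro g
  simp only [torus_gen, SkewData.der_gen, map_smul]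
  cases g <;> simp [SkewData.toFun, leftFData, torus_gen, weight, smul_smul] <;> match_scalars <;>
    field_simp

theorem torus_rightE (u w : 𝕜ˣ) (x : GLqPlus q) : torus q u w ((rightEData q).der x) =
    ((w ^ 2 : 𝕜ˣ) : 𝕜) • (rightEData q).der (torus q u w x) := by
  refine SkewData.torus_comm (rightEData q) u w ((w ^ 2 : 𝕜ˣ) : 𝕜)
    (torus_comm_torus u w 1 q⁻¹) (fun y => by rw [AlgHom.id_apply, AlgHom.id_apply]) ?_ x
  intro g
  simp only [torus_gen, SkewData.der_gen, map_smul]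
  cases g <;> simp [SkewData.toFun, rightEData, torus_gen, weight, smul_smul] <;> match_scalars <;>
    field_simp

theorem torus_rightF (u w : 𝕜ˣ) (x : GLqPlus q) : torus q u w ((rightFData q).der x) =
    (((w ^ 2)⁻¹ : 𝕜ˣ) : 𝕜) • (rightFData q).der (torus q u w x) := by
  refine SkewData.torus_comm (rightFData q) u w (((w ^ 2)⁻¹ : 𝕜ˣ) : 𝕜)
    (fun y => by rw [AlgHom.id_apply, AlgHom.id_apply]) (torus_comm_torus u w 1 q) ?_ x
  intro g
  simp only [torus_gen, SkewData.der_gen, map_smul]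
  cases g <;> simp [SkewData.toFun, rightFData, torus_gen, weight, smul_smul] <;> match_scalars <;>
    field_simp

/-- The relation between `E` and `F` propagates from the generators to the whole algebra. -/
theorem E_F_aux {k k' : GLqPlus q →ₐ[𝕜] GLqPlus q} (dE : SkewData q k (AlgHom.id 𝕜 _))
    (dF : SkewData q (AlgHom.id 𝕜 _) k') (s c : 𝕜)
    (hF : ∀ x, k (dF.der x) = c • dF.der (k x)) (hE : ∀ x, k' (dE.der x) = c • dE.der (k' x))
    (h : ∀ x, s • (dE.der (dF.der (gen q x)) - dF.der (dE.der (gen q x))) =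
      k (gen q x) - k' (gen q x)) (x : GLqPlus q) :
    s • (dE.der (dF.der x) - dF.der (dE.der x)) = k x - k' x := by
  induction x using induction with
  | hg x => exact h x
  | hc a => simp [SkewData.der_algebraMap]
  | ha x y h1 h2 =>
    simp only [map_add, add_sub_add_comm, smul_add, h1, h2]
  | hm x y h1 h2 =>
    have e1 : dE.der (dF.der (x * y)) - dF.der (dE.der (x * y)) =
        k x * (dE.der (dF.der y) - dF.der (dE.der y)) +
        (dE.der (dF.der x) - dF.der (dE.der x)) * k' y := by
      simp only [SkewData.der_mul, map_add, AlgHom.id_apply, hF, hE, smul_mul_assoc,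
        mul_smul_comm, mul_sub, sub_mul]
      abel
    rw [e1, smul_add, ← mul_smul_comm, ← smul_mul_assoc, h1, h2, map_mul, map_mul]
    noncomm_ring

variable (q)

/-- The first action of `U_q(gl(2))` on `GL_q^+(2)`, on the factor `V`. -/
def leftData : UData q (Module.End 𝕜 (GLqPlus q)) where
  E := (leftEData q).der
  F := (leftFData q).der
  K := (torus q q 1).toLinearMap
  Kinv := (torus q q⁻¹ 1).toLinearMap
  I := (degData q).der
  K_Kinv := by ext x; simp [Module.End.mul_apply, torus_torus, torus_one]
  Kinv_K := by ext x; simp [Module.End.mul_apply, torus_torus, torus_one]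
  K_E := LinearMap.ext fun x => torus_leftE q 1 x
  K_F := LinearMap.ext fun x => torus_leftF q 1 x
  E_F := LinearMap.ext fun x => by
    refine E_F_aux (leftEData q) (leftFData q) _ (((q ^ 2)⁻¹ : 𝕜ˣ) : 𝕜) (torus_leftF q 1) ?_ ?_ x
    · intro x
      rw [torus_leftE, inv_pow]
    · intro g
      cases g <;> simp [SkewData.der_gen, SkewData.toFun, leftEData, leftFData, torus_gen, weight]
        <;> module
  I_E := LinearMap.ext fun x => by
    refine SkewData.comm (degData q) (leftEData q) (fun _ => rfl) (fun _ => rfl) (fun _ => rfl)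
      (fun _ => rfl) (deg_torus _ _) (fun _ => rfl) ?_ x
    intro g
    cases g <;> simp [SkewData.der_gen, SkewData.toFun, leftEData, degData]
  I_F := LinearMap.ext fun x => by
    refine SkewData.comm (degData q) (leftFData q) (fun _ => rfl) (fun _ => rfl) (fun _ => rfl)
      (fun _ => rfl) (fun _ => rfl) (deg_torus _ _) ?_ x
    intro g
    cases g <;> simp [SkewData.der_gen, SkewData.toFun, leftFData, degData]
  I_K := LinearMap.ext fun x => deg_torus q 1 x
  I_Kinv := LinearMap.ext fun x => deg_torus q⁻¹ 1 x

/-- The second action, of `U_{q⁻¹}(gl(2))`, on `GL_q^+(2)`, on the factor `V̄`. -/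
def rightData : UData q⁻¹ (Module.End 𝕜 (GLqPlus q)) where
  E := (rightEData q).der
  F := (rightFData q).der
  K := (torus q 1 q⁻¹).toLinearMap
  Kinv := (torus q 1 q).toLinearMap
  I := (degData q).der
  K_Kinv := by ext x; simp [Module.End.mul_apply, torus_torus, torus_one]
  Kinv_K := by ext x; simp [Module.End.mul_apply, torus_torus, torus_one]
  K_E := LinearMap.ext fun x => torus_rightE 1 q⁻¹ x
  K_F := LinearMap.ext fun x => torus_rightF 1 q⁻¹ x
  E_F := LinearMap.ext fun x => by
    refine E_F_aux (rightEData q) (rightFData q) _ (((q⁻¹ ^ 2)⁻¹ : 𝕜ˣ) : 𝕜)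
      (torus_rightF 1 q⁻¹) ?_ ?_ x
    · intro x
      rw [torus_rightE, inv_pow, inv_inv]
    · intro g
      cases g <;> simp [SkewData.der_gen, SkewData.toFun, rightEData, rightFData, torus_gen, weight]
        <;> module
  I_E := LinearMap.ext fun x => by
    refine SkewData.comm (degData q) (rightEData q) (fun _ => rfl) (fun _ => rfl) (fun _ => rfl)
      (fun _ => rfl) (deg_torus _ _) (fun _ => rfl) ?_ x
    intro g
    cases g <;> simp [SkewData.der_gen, SkewData.toFun, rightEData, degData]
  I_F := LinearMap.ext fun x => by
    refine SkewData.comm (degData q) (rightFData q) (fun _ => rfl) (fun _ => rfl) (fun _ => rfl)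
      (fun _ => rfl) (fun _ => rfl) (deg_torus _ _) ?_ x
    intro g
    cases g <;> simp [SkewData.der_gen, SkewData.toFun, rightFData, degData]
  I_K := LinearMap.ext fun x => deg_torus 1 q⁻¹ x
  I_Kinv := LinearMap.ext fun x => deg_torus 1 q x

theorem left_right_gen (a b : UGen) (x : GLqPlus q) :
    (leftData q).toFun a ((rightData q).toFun b x) =
      (rightData q).toFun b ((leftData q).toFun a x) := by
  have hE : ∀ w x, torus q 1 w ((leftEData q).der x) = (leftEData q).der (torus q 1 w x) := by
    intro w x; rw [torus_leftE]; simp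
  have hF : ∀ w x, torus q 1 w ((leftFData q).der x) = (leftFData q).der (torus q 1 w x) := by
    intro w x; rw [torus_leftF]; simp
  have hE' : ∀ u x, torus q u 1 ((rightEData q).der x) = (rightEData q).der (torus q u 1 x) := by
    intro w x; rw [torus_rightE]; simp
  have hF' : ∀ u x, torus q u 1 ((rightFData q).der x) = (rightFData q).der (torus q u 1 x) := by
    intro w x; rw [torus_rightF]; simp
  have hI : ∀ b x, (degData q).der ((rightData q).toFun b x) =
      (rightData q).toFun b ((degData q).der x) := by
    intro b x
    cases b
    · exact LinearMap.congr_fun (rightData q).I_E x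
    · exact LinearMap.congr_fun (rightData q).I_F x
    · exact LinearMap.congr_fun (rightData q).I_K x
    · exact LinearMap.congr_fun (rightData q).I_Kinv x
    · rfl
  have hI' : ∀ a x, (leftData q).toFun a ((degData q).der x) =
      (degData q).der ((leftData q).toFun a x) := by
    intro b x
    cases b
    · exact (LinearMap.congr_fun (leftData q).I_E x).symm
    · exact (LinearMap.congr_fun (leftData q).I_F x).symm
    · exact (LinearMap.congr_fun (leftData q).I_K x).symm
    · exact (LinearMap.congr_fun (leftData q).I_Kinv x).symm
    · rfl
  cases a <;> cases b
  case I.E => exact hI .E x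
  case I.F => exact hI .F x
  case I.K => exact hI .K x
  case I.Kinv => exact hI .Kinv x
  case I.I => rfl
  case E.I => exact hI' .E x
  case F.I => exact hI' .F x
  case K.I => exact hI' .K x
  case Kinv.I => exact hI' .Kinv x
  case E.K => exact (hE _ x).symm
  case E.Kinv => exact (hE _ x).symm
  case F.K => exact (hF _ x).symm
  case F.Kinv => exact (hF _ x).symm
  case K.E => exact hE' _ x
  case Kinv.E => exact hE' _ x
  case K.F => exact hF' _ x
  case Kinv.F => exact hF' _ x
  case K.K => exact torus_comm_torus _ _ _ _ x
  case K.Kinv => exact torus_comm_torus _ _ _ _ x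
  case Kinv.K => exact torus_comm_torus _ _ _ _ x
  case Kinv.Kinv => exact torus_comm_torus _ _ _ _ x
  case E.E =>
    refine SkewData.comm (leftEData q) (rightEData q) (torus_comm_torus _ _ _ _) (fun _ => rfl)
      (hE' _) (fun _ => rfl) (fun x => (hE _ x).symm) (fun _ => rfl) ?_ x
    intro g
    cases g <;> simp [SkewData.der_gen, SkewData.toFun, leftEData, rightEData]
  case E.F =>
    refine SkewData.comm (leftEData q) (rightFData q) (fun _ => rfl) (fun _ => rfl)
      (hF' _) (fun _ => rfl) (fun _ => rfl) (fun x => (hE _ x).symm) ?_ x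
    intro g
    cases g <;> simp [SkewData.der_gen, SkewData.toFun, leftEData, rightFData]
  case F.E =>
    refine SkewData.comm (leftFData q) (rightEData q) (fun _ => rfl) (fun _ => rfl)
      (fun _ => rfl) (hE' _) (fun x => (hF _ x).symm) (fun _ => rfl) ?_ x
    intro g
    cases g <;> simp [SkewData.der_gen, SkewData.toFun, leftFData, rightEData]
  case F.F =>
    refine SkewData.comm (leftFData q) (rightFData q) (fun _ => rfl) (torus_comm_torus _ _ _ _)
      (fun _ => rfl) (hF' _) (fun _ => rfl) (fun x => (hF _ x).symm) ?_ x
    intro g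
    cases g <;> simp [SkewData.der_gen, SkewData.toFun, leftFData, rightFData]

theorem left_right (a : Uq q) (b : Uq q⁻¹) :
    Commute ((leftData q).lift a) ((rightData q).lift b) := by
  have ha : a ∈ Algebra.adjoin 𝕜 (Set.range (Uq.gen q)) := by rw [Uq.adjoin_gen]; trivial
  have hb : b ∈ Algebra.adjoin 𝕜 (Set.range (Uq.gen q⁻¹)) := by rw [Uq.adjoin_gen]; trivial
  induction ha using Algebra.adjoin_induction with
  | mem a ha =>
    obtain ⟨a, rfl⟩ := ha
    induction hb using Algebra.adjoin_induction with
    | mem b hb =>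
      obtain ⟨b, rfl⟩ := hb
      rw [UData.lift_gen, UData.lift_gen]
      exact LinearMap.ext fun x => left_right_gen q a b x
    | algebraMap c => rw [AlgHom.commutes]; exact Algebra.commute_algebraMap_right _ _
    | add x y _ _ h1 h2 => rw [map_add]; exact h1.add_right h2
    | mul x y _ _ h1 h2 => rw [map_mul]; exact h1.mul_right h2
  | algebraMap c => rw [AlgHom.commutes]; exact Algebra.commute_algebraMap_left _ _
  | add x y _ _ h1 h2 => rw [map_add]; exact h1.add_left h2
  | mul x y _ _ h1 h2 => rw [map_mul]; exact h1.mul_left h2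

/-- The action of `U_q(gl(2)) ⊗ U_{q⁻¹}(gl(2))` on `GL_q^+(2)`. -/
def action : Uq q ⊗[𝕜] Uq q⁻¹ →ₐ[𝕜] Module.End 𝕜 (GLqPlus q) :=
  Algebra.TensorProduct.lift (leftData q).lift (rightData q).lift (left_right q)

instance : Module (Uq q ⊗[𝕜] Uq q⁻¹) (GLqPlus q) :=
  Module.compHom _ (action q).toRingHom

theorem smul_def (a : Uq q ⊗[𝕜] Uq q⁻¹) (x : GLqPlus q) : a • x = action q a x := rfl

instance : IsScalarTower 𝕜 (Uq q ⊗[𝕜] Uq q⁻¹) (GLqPlus q) where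
  smul_assoc c a x := by simp only [smul_def, map_smul, LinearMap.smul_apply]

end GLqPlus

/-! ### The representations `V_{l,k} ⊗ V̄_{l,k}` and their isotypic components -/

/-- The space `V_{l,k} ⊗ V̄_{l,k}`, where `V̄_{l,k}` is `V_{l,k}` for the parameter `q⁻¹`. -/
def VVbar (q : 𝕜ˣ) (l : ℕ) (k : ℤ) : Type _ := Vrep q l k ⊗[𝕜] Vrep q⁻¹ l k

instance (q : 𝕜ˣ) (l : ℕ) (k : ℤ) : AddCommGroup (VVbar q l k) :=
  inferInstanceAs (AddCommGroup (Vrep q l k ⊗[𝕜] Vrep q⁻¹ l k))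
instance (q : 𝕜ˣ) (l : ℕ) (k : ℤ) : Module 𝕜 (VVbar q l k) :=
  inferInstanceAs (Module 𝕜 (Vrep q l k ⊗[𝕜] Vrep q⁻¹ l k))

/-- The outer tensor product action of `U_q(gl(2)) ⊗ U_{q⁻¹}(gl(2))` on `V_{l,k} ⊗ V̄_{l,k}`. -/
def VVbar.action (q : 𝕜ˣ) (l : ℕ) (k : ℤ) :
    Uq q ⊗[𝕜] Uq q⁻¹ →ₐ[𝕜] Module.End 𝕜 (Vrep q l k ⊗[𝕜] Vrep q⁻¹ l k) :=
  (Module.endTensorEndAlgHom (R := 𝕜) (S := 𝕜) (A := 𝕜)).comp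
    (Algebra.TensorProduct.map (Vrep.data q l k).lift (Vrep.data q⁻¹ l k).lift)

instance (q : 𝕜ˣ) (l : ℕ) (k : ℤ) : Module (Uq q ⊗[𝕜] Uq q⁻¹) (VVbar q l k) :=
  Module.compHom (Vrep q l k ⊗[𝕜] Vrep q⁻¹ l k) (VVbar.action q l k).toRingHom

/-- The subspace `V_{l,k} ⊗ V̄_{l,k}` of `GL_q^+(2)`: the sum of all subrepresentations of
`GL_q^+(2)` that are isomorphic to the irreducible representation `V_{l,k} ⊗ V̄_{l,k}` of
`U_q(gl(2)) ⊗ U_{q⁻¹}(gl(2))`. -/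
def component (q : 𝕜ˣ) (l : ℕ) (k : ℤ) : Submodule 𝕜 (GLqPlus q) :=
  (isotypicComponent (Uq q ⊗[𝕜] Uq q⁻¹) (GLqPlus q) (VVbar q l k)).restrictScalars 𝕜

/-! ### The extension by `δ` and the elements `Y` -/

/-- The generators of the extension of `GL_q^+(2)` by an invertible element `δ`. -/
inductive ExtGen
  | A | B | C | D | del | delInv

/-- The generators of `GL_q^+(2)` among those of the extension. -/
def MatGen.toExt : MatGen → ExtGen
  | .A => .A
  | .B => .B
  | .C => .C
  | .D => .D

open FreeAlgebra in
/-- The defining relations of the extension of `GL_q^+(2)` by `δ`: those of `GL_q^+(2)`,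
invertibility of `δ`, and the commutation relations of `δ` with the generators. -/
inductive ExtRel (q : 𝕜ˣ) : FreeAlgebra 𝕜 ExtGen → FreeAlgebra 𝕜 ExtGen → Prop
  | mat {x y : FreeAlgebra 𝕜 MatGen} (h : MatRel q x y) :
      ExtRel q (FreeAlgebra.lift 𝕜 (fun g => ι 𝕜 g.toExt) x)
        (FreeAlgebra.lift 𝕜 (fun g => ι 𝕜 g.toExt) y)
  | del_delInv : ExtRel q (ι 𝕜 ExtGen.del * ι 𝕜 ExtGen.delInv) 1
  | delInv_del : ExtRel q (ι 𝕜 ExtGen.delInv * ι 𝕜 ExtGen.del) 1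
  | del_A : ExtRel q (ι 𝕜 ExtGen.del * ι 𝕜 ExtGen.A) (ι 𝕜 ExtGen.A * ι 𝕜 ExtGen.del)
  | del_B : ExtRel q (ι 𝕜 ExtGen.del * ι 𝕜 ExtGen.B)
      ((q : 𝕜) • (ι 𝕜 ExtGen.B * ι 𝕜 ExtGen.del))
  | del_C : ExtRel q (ι 𝕜 ExtGen.del * ι 𝕜 ExtGen.C)
      (((q⁻¹ : 𝕜ˣ) : 𝕜) • (ι 𝕜 ExtGen.C * ι 𝕜 ExtGen.del))
  | del_D : ExtRel q (ι 𝕜 ExtGen.del * ι 𝕜 ExtGen.D) (ι 𝕜 ExtGen.D * ι 𝕜 ExtGen.del)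

/-- The extension of `GL_q^+(2)` by the invertible element `δ`. -/
def GLqExt (q : 𝕜ˣ) : Type _ := RingQuot (ExtRel q)

instance (q : 𝕜ˣ) : Ring (GLqExt q) := inferInstanceAs (Ring (RingQuot (ExtRel q)))
instance (q : 𝕜ˣ) : Algebra 𝕜 (GLqExt q) := inferInstanceAs (Algebra 𝕜 (RingQuot (ExtRel q)))

namespace GLqExt

variable (q : 𝕜ˣ)

/-- The generators as elements of the extension. -/
def gen (g : ExtGen) : GLqExt q := RingQuot.mkAlgHom 𝕜 (ExtRel q) (FreeAlgebra.ι 𝕜 g)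

/-- The canonical homomorphism from `GL_q^+(2)` to its extension by `δ`. -/
def incl : GLqPlus q →ₐ[𝕜] GLqExt q :=
  RingQuot.liftAlgHom 𝕜 ⟨(RingQuot.mkAlgHom 𝕜 (ExtRel q)).comp
      (FreeAlgebra.lift 𝕜 (fun g : MatGen => FreeAlgebra.ι 𝕜 g.toExt)),
    fun _ _ h => RingQuot.mkAlgHom_rel 𝕜 (ExtRel.mat h)⟩

theorem incl_gen (g : MatGen) : incl q (GLqPlus.gen q g) = gen q g.toExt := by
  unfold incl GLqPlus.gen gen
  refine (RingQuot.liftAlgHom_mkAlgHom_apply _ _ _ _).trans ?_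
  exact congrArg (RingQuot.mkAlgHom 𝕜 (ExtRel q)) (FreeAlgebra.lift_ι_apply _ _)

/-- The invertible element `δ`. -/
def del : (GLqExt q)ˣ where
  val := gen q .del
  inv := gen q .delInv
  val_inv := by
    have h := RingQuot.mkAlgHom_rel 𝕜 (ExtRel.del_delInv (q := q))
    rw [map_mul, map_one] at h
    exact h
  inv_val := by
    have h := RingQuot.mkAlgHom_rel 𝕜 (ExtRel.delInv_del (q := q))
    rw [map_mul, map_one] at h
    exact h

/-- `x₁₁ = δ A`. -/
def x11 : GLqExt q := del q * gen q .A

/-- `x₁₂ = q^{-1/2} δ B`, where `h` is the chosen square root of `q`. -/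
def x12 (h : 𝕜ˣ) : GLqExt q := ((h⁻¹ : 𝕜ˣ) : 𝕜) • (del q * gen q .B)

/-- `x₂₁ = q^{1/2} δ C`, where `h` is the chosen square root of `q`. -/
def x21 (h : 𝕜ˣ) : GLqExt q := (h : 𝕜) • (del q * gen q .C)

/-- `x₂₂ = δ D`. -/
def x22 : GLqExt q := del q * gen q .D

/-- `det(x) = x₁₁ x₂₂ - x₁₂ x₂₁`. -/
def detx (h : 𝕜ˣ) : GLqExt q := x11 q * x22 q - x12 q h * x21 q h

open LaurentPolynomial in
/-- `X^l_{r,k} = (1 / 2πi) ∮ (x₁₁ s + x₂₁)^{(l-r)/2} (x₁₂ s + x₂₂)^{(l+r)/2} s^{(k-l)/2-1} ds`.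
The integrand is a Laurent polynomial in the central variable `s`, here `T 1`, and the contour
integral around `0` is its residue, the coefficient of `s⁻¹`. -/
def X (h : 𝕜ˣ) (l : ℕ) (r k : ℤ) : GLqExt q :=
  ((C (x11 q) * T 1 + C (x21 q h)) ^ (((l : ℤ) - r) / 2).toNat *
    (C (x12 q h) * T 1 + C (x22 q)) ^ (((l : ℤ) + r) / 2).toNat *
    T ((k - l) / 2 - 1)).coeff (-1)

/-- `Y^{l,j}_{r,k} = δ^{-2j-l} det(x)^j X^l_{r,k}`. -/
def Y (h : 𝕜ˣ) (l j : ℕ) (r k : ℤ) : GLqExt q :=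
  ((del q ^ (-2 * (j : ℤ) - l) : (GLqExt q)ˣ) : GLqExt q) * detx q h ^ j * X q h l r k

end GLqExt

/-- The range of each of the indices `r` and `k`: integers between `-l` and `l` that are congruent
to `l` modulo `2`. -/
abbrev Idx (l : ℕ) : Type := {r : ℤ // -(l : ℤ) ≤ r ∧ r ≤ l ∧ r ≡ l [ZMOD 2]}

end

end QuantumGL

open scoped TensorProduct LaurentPolynomial

namespace QuantumGL

noncomputable section

variable {𝕜 : Type*} [Field 𝕜]

-- The Poincaré–Birkhoff–Witt basis of ordered monomials

namespace GLqPlus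

variable (q : 𝕜ˣ)

-- The representation V_{l,l+2j} ⊗ V̄_{l,l+2j} occurs in GL_q^+(2) with multiplicity one. Its
-- highest weight vector is det_q^j B^l, where det_q = A D - q⁻¹ B C is annihilated by E, F, Ē, F̄
-- and fixed by the tori. The elements Y are, up to nonzero scalars, the vectors obtained from it by
-- divided powers of F and F̄.
--
-- Multiplicity one rests on the basis of ordered monomials. The two weights and the degree of a
-- highest weight vector allow only the monomials A^(j-n) B^(l+n) C^n D^(j-n), and the equation E x
-- = 0 is a two-term recursion in n with nonzero coefficients, since q is not a root of unity. Hence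
-- the vector is determined by one coefficient (`eq_zero_of_highestWeight`). A homomorphism from V ⊗
-- V̄ is determined by the image of its highest weight vector, so all of them are multiples of
-- `embedding` (`exists_eq_smul_embedding`), and the isotypic component is the range of `embedding`
-- (`isotypicComponent_eq`). This map is injective because it sends the tensor basis to eigenvectors
-- with distinct eigenvalues.
--
-- The divided powers are computed with a generating function. B^l is the top coefficient in s of (B
-- s + q^(l-1) D) ⋯ (B s + D). There F̄ lowers the power of s (`rightF_rowProd`). F replaces a row
-- (B, D) by a row (A, C), which can be moved to the front because the rows commute up to a factor q
-- (`leftF_chain`). The results are the coefficients of `chain`. On the other side, moving every δ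
-- to the left turns the integrand of X into the same product of rows, and the powers of δ in Y
-- cancel (`exists_Y_eq`). So Y is the image of an element of GL_q^+(2), and it is a unit multiple
-- of the image of a basis vector of V ⊗ V̄.
--
-- Injectivity of the canonical map follows by letting the extension act on GL_q^+(2), with δ acting
-- by an automorphism, and evaluating at 1.

/-- The space with one basis vector for each ordered monomial `A ^ a * B ^ b * C ^ c * D ^ d`. -/
abbrev MonSpace (𝕜 : Type*) [Field 𝕜] : Type _ := (ℕ × ℕ × ℕ × ℕ) →₀ 𝕜

set_option linter.unusedSimpArgs false in
/-- Left multiplication by the generators in terms of the ordered monomials. -/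
def monRepData : MatData q (Module.End 𝕜 (MonSpace 𝕜)) where
  A := Finsupp.linearCombination 𝕜 fun m => Finsupp.single (m.1 + 1, m.2) 1
  B := Finsupp.linearCombination 𝕜 fun m =>
    (q : 𝕜) ^ m.1 • Finsupp.single (m.1, m.2.1 + 1, m.2.2) 1
  C := Finsupp.linearCombination 𝕜 fun m =>
    (q : 𝕜) ^ m.1 • Finsupp.single (m.1, m.2.1, m.2.2.1 + 1, m.2.2.2) 1
  D := Finsupp.linearCombination 𝕜 fun m =>
    (q : 𝕜) ^ (m.2.1 + m.2.2.1) • Finsupp.single (m.1, m.2.1, m.2.2.1, m.2.2.2 + 1) 1 +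
    ((q : 𝕜)⁻¹ * ((q : 𝕜) ^ (2 * m.1) - 1)) •
      Finsupp.single (m.1 - 1, m.2.1 + 1, m.2.2.1 + 1, m.2.2.2) 1
  A_B := by
    refine Finsupp.lhom_ext' fun ⟨a, b, c, d⟩ => LinearMap.ext_ring ?_
    simp only [LinearMap.comp_apply, Finsupp.lsingle_apply, Module.End.mul_apply, map_add, map_smul,
      LinearMap.smul_apply, LinearMap.sub_apply, Finsupp.linearCombination_single, one_smul, smul_add, smul_smul,
      Nat.add_sub_cancel, Units.val_inv_eq_inv_val]
    match_scalars <;> field_simp <;> try ring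
  C_B := by
    refine Finsupp.lhom_ext' fun ⟨a, b, c, d⟩ => LinearMap.ext_ring ?_
    simp only [LinearMap.comp_apply, Finsupp.lsingle_apply, Module.End.mul_apply, map_add, map_smul,
      LinearMap.smul_apply, LinearMap.sub_apply, Finsupp.linearCombination_single, one_smul, smul_add, smul_smul,
      Nat.add_sub_cancel, Units.val_inv_eq_inv_val]
  D_B := by
    refine Finsupp.lhom_ext' fun ⟨a, b, c, d⟩ => LinearMap.ext_ring ?_
    -- The truncated exponent `m.1 - 1` in `D` is harmless because its coefficient contains q^(2a) -
    -- 1, which vanishes at a = 0. That case is therefore separated.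
    rcases a with _ | a
    · simp only [LinearMap.comp_apply, Finsupp.lsingle_apply, Module.End.mul_apply, map_add, map_smul,
        LinearMap.smul_apply, LinearMap.sub_apply, Finsupp.linearCombination_single, one_smul, smul_add, smul_smul,
        Nat.add_sub_cancel, Units.val_inv_eq_inv_val]
      simp only [mul_zero, pow_zero, sub_self, zero_smul, smul_zero, add_zero, zero_add]
      match_scalars <;> field_simp <;> try ring
    · simp only [LinearMap.comp_apply, Finsupp.lsingle_apply, Module.End.mul_apply, map_add, map_smul,
        LinearMap.smul_apply, LinearMap.sub_apply, Finsupp.linearCombination_single, one_smul, smul_add, smul_smul,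
        Nat.add_sub_cancel, Units.val_inv_eq_inv_val]
      match_scalars <;> field_simp <;> try ring
  C_A := by
    refine Finsupp.lhom_ext' fun ⟨a, b, c, d⟩ => LinearMap.ext_ring ?_
    simp only [LinearMap.comp_apply, Finsupp.lsingle_apply, Module.End.mul_apply, map_add, map_smul,
      LinearMap.smul_apply, LinearMap.sub_apply, Finsupp.linearCombination_single, one_smul, smul_add, smul_smul,
      Nat.add_sub_cancel, Units.val_inv_eq_inv_val]
    match_scalars <;> field_simp <;> try ring
  A_D := by
    refine Finsupp.lhom_ext' fun ⟨a, b, c, d⟩ => LinearMap.ext_ring ?_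
    rcases a with _ | a
    · simp only [LinearMap.comp_apply, Finsupp.lsingle_apply, Module.End.mul_apply, map_add, map_smul,
        LinearMap.smul_apply, LinearMap.sub_apply, Finsupp.linearCombination_single, one_smul, smul_add, smul_smul,
        Nat.add_sub_cancel, Units.val_inv_eq_inv_val]
      simp only [mul_zero, pow_zero, sub_self, zero_smul, smul_zero, add_zero, zero_add]
      match_scalars <;> field_simp <;> try ring
    · simp only [LinearMap.comp_apply, Finsupp.lsingle_apply, Module.End.mul_apply, map_add, map_smul,
        LinearMap.smul_apply, LinearMap.sub_apply, Finsupp.linearCombination_single, one_smul, smul_add, smul_smul,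
        Nat.add_sub_cancel, Units.val_inv_eq_inv_val]
      match_scalars <;> field_simp <;> try ring
  C_D := by
    refine Finsupp.lhom_ext' fun ⟨a, b, c, d⟩ => LinearMap.ext_ring ?_
    rcases a with _ | a
    · simp only [LinearMap.comp_apply, Finsupp.lsingle_apply, Module.End.mul_apply, map_add, map_smul,
        LinearMap.smul_apply, LinearMap.sub_apply, Finsupp.linearCombination_single, one_smul, smul_add, smul_smul,
        Nat.add_sub_cancel, Units.val_inv_eq_inv_val]
      simp only [mul_zero, pow_zero, sub_self, zero_smul, smul_zero, add_zero, zero_add]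
      match_scalars <;> field_simp <;> try ring
    · simp only [LinearMap.comp_apply, Finsupp.lsingle_apply, Module.End.mul_apply, map_add, map_smul,
        LinearMap.smul_apply, LinearMap.sub_apply, Finsupp.linearCombination_single, one_smul, smul_add, smul_smul,
        Nat.add_sub_cancel, Units.val_inv_eq_inv_val]
      match_scalars <;> field_simp <;> try ring

/-- The ordered monomial `A ^ a * B ^ b * C ^ c * D ^ d`. -/
def mon (m : ℕ × ℕ × ℕ × ℕ) : GLqPlus q :=
  gen q .A ^ m.1 * gen q .B ^ m.2.1 * gen q .C ^ m.2.2.1 * gen q .D ^ m.2.2.2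

variable {q} in
theorem mul_pow_of_skew {R : Type*} [Ring R] [Algebra 𝕜 R] {x y : R} {c : 𝕜}
    (h : x * y = c • (y * x)) (n : ℕ) : x * y ^ n = c ^ n • (y ^ n * x) := by
  induction n with
  | zero => simp
  | succ n ih =>
    rw [pow_succ, ← mul_assoc, ih, smul_mul_assoc, mul_assoc, h, mul_smul_comm, smul_smul,
      mul_assoc, pow_succ]

theorem B_mul_pow_A (n : ℕ) : gen q .B * gen q .A ^ n = (q : 𝕜) ^ n • (gen q .A ^ n * gen q .B) :=
  mul_pow_of_skew (BA q) n

theorem C_mul_pow_A (n : ℕ) : gen q .C * gen q .A ^ n = (q : 𝕜) ^ n • (gen q .A ^ n * gen q .C) :=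
  mul_pow_of_skew (CA q) n

theorem C_mul_pow_B (n : ℕ) : gen q .C * gen q .B ^ n = gen q .B ^ n * gen q .C :=
  ((show Commute _ _ from CB q).pow_right n).eq

theorem D_mul_pow_B (n : ℕ) : gen q .D * gen q .B ^ n = (q : 𝕜) ^ n • (gen q .B ^ n * gen q .D) :=
  mul_pow_of_skew (DB q) n

theorem D_mul_pow_C (n : ℕ) : gen q .D * gen q .C ^ n = (q : 𝕜) ^ n • (gen q .C ^ n * gen q .D) :=
  mul_pow_of_skew (DC q) n

/-- Each exchange of D with one A produces (q - q⁻¹) B C, and B C passes each further A with a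
factor q². The geometric sum (q - q⁻¹)(1 + q² + ⋯ + q^(2n-2)) equals q⁻¹(q^(2n) - 1). -/
theorem D_mul_pow_A (n : ℕ) : gen q .D * gen q .A ^ n = gen q .A ^ n * gen q .D +
    ((q : 𝕜)⁻¹ * ((q : 𝕜) ^ (2 * n) - 1)) • (gen q .A ^ (n - 1) * gen q .B * gen q .C) := by
  induction n with
  | zero => simp
  | succ n ih =>
    have h1 : gen q .A ^ (n - 1) * gen q .B * gen q .C * gen q .A =
        ((q : 𝕜) ^ 2) • (gen q .A ^ (n - 1) * gen q .A * gen q .B * gen q .C) := by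
      simp only [mul_assoc, CA, mul_smul_comm]
      rw [← mul_assoc (gen q .B), BA]
      simp only [mul_smul_comm, smul_mul_assoc, smul_smul, mul_assoc, pow_two]
    rw [pow_succ, ← mul_assoc, ih, add_mul, smul_mul_assoc, h1, mul_assoc, DA, mul_sub,
      Nat.add_sub_cancel]
    rcases n with _ | n
    · simp
      match_scalars <;> field_simp
      ring
    · rw [Nat.add_sub_cancel, ← pow_succ]
      simp only [mul_smul_comm, mul_assoc, smul_smul]
      match_scalars <;> field_simp
      ring

theorem gen_mul_mon (g : MatGen) (m : ℕ × ℕ × ℕ × ℕ) : gen q g * mon q m =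
    Finsupp.linearCombination 𝕜 (mon q) ((monRepData q).toFun g (Finsupp.single m 1)) := by
  obtain ⟨a, b, c, d⟩ := m
  cases g
  · simp [-Finsupp.smul_single, monRepData, MatData.toFun, Finsupp.linearCombination_single, mon, pow_succ', mul_assoc]
  · simp [-Finsupp.smul_single, monRepData, MatData.toFun, Finsupp.linearCombination_single, mon]
    simp only [← mul_assoc, B_mul_pow_A, smul_mul_assoc]
    rw [mul_assoc (gen q .A ^ a) (gen q .B), ← pow_succ']
  · simp [-Finsupp.smul_single, monRepData, MatData.toFun, Finsupp.linearCombination_single, mon]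
    simp only [← mul_assoc, C_mul_pow_A, smul_mul_assoc]
    rw [mul_assoc (gen q .A ^ a) (gen q .C), C_mul_pow_B, pow_succ']
    simp only [mul_assoc]
  · simp [-Finsupp.smul_single, monRepData, MatData.toFun, Finsupp.linearCombination_single, mon]
    simp only [← mul_assoc, D_mul_pow_A, smul_mul_assoc, add_mul]
    congr 1
    · rw [mul_assoc (gen q .A ^ a) (gen q .D), D_mul_pow_B, mul_smul_comm, smul_mul_assoc,
        ← mul_assoc, mul_assoc _ (gen q .D), D_mul_pow_C, mul_smul_comm]
      simp only [mul_assoc, smul_mul_assoc, smul_smul, pow_succ', pow_add]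
    · rw [mul_assoc _ (gen q .C), C_mul_pow_B]
      simp only [mul_assoc, pow_succ']

/-- The operators of `monRepData` were read off from reordering a generator times an ordered
monomial, so the map to GL_q^+(2) intertwines them with left multiplication. Applied to the vector
of the empty monomial, this shows that the ordered monomials span. -/
theorem mul_linearCombination_mon (x : GLqPlus q) (v : MonSpace 𝕜) :
    x * Finsupp.linearCombination 𝕜 (mon q) v =
      Finsupp.linearCombination 𝕜 (mon q) ((monRepData q).lift x v) := by
  induction x using induction generalizing v with
  | hg g =>
    rw [lift_gen]
    induction v using Finsupp.induction_linear with
    | zero => simp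
    | add v w h1 h2 => simp only [map_add, mul_add, h1, h2]
    | single m c =>
      rw [← Finsupp.smul_single_one, map_smul, map_smul, map_smul, mul_smul_comm, ← gen_mul_mon, Finsupp.linearCombination_single, one_smul]
  | hc c => simp [Algebra.smul_def]
  | ha x y h1 h2 => simp only [map_add, add_mul, h1, h2, LinearMap.add_apply]
  | hm x y h1 h2 => rw [mul_assoc, h2, h1, map_mul, Module.End.mul_apply]

/-- Independence of the monomials. If D, C, B, A are applied in this order to the vector of the
empty monomial, all powers of q are trivial and the second term of `D` never appears, so evaluation
at that vector recovers the exponents. -/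
theorem lift_mon (m : ℕ × ℕ × ℕ × ℕ) :
    (monRepData q).lift (mon q m) (Finsupp.single 0 1) = Finsupp.single m 1 := by
  obtain ⟨a, b, c, d⟩ := m
  have hD : ((monRepData q).D ^ d) (Finsupp.single 0 1) = Finsupp.single (0, 0, 0, d) 1 := by
    induction d with
    | zero => rfl
    | succ d ih =>
      rw [pow_succ', Module.End.mul_apply, ih]
      simp [-Finsupp.smul_single, monRepData, Finsupp.linearCombination_single]
  have hC : ((monRepData q).C ^ c) (Finsupp.single (0, 0, 0, d) 1) =
      Finsupp.single (0, 0, c, d) 1 := by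
    induction c with
    | zero => rfl
    | succ d ih =>
      rw [pow_succ', Module.End.mul_apply, ih]
      simp [-Finsupp.smul_single, monRepData, Finsupp.linearCombination_single]
  have hB : ((monRepData q).B ^ b) (Finsupp.single (0, 0, c, d) 1) =
      Finsupp.single (0, b, c, d) 1 := by
    induction b with
    | zero => rfl
    | succ d ih =>
      rw [pow_succ', Module.End.mul_apply, ih]
      simp [-Finsupp.smul_single, monRepData, Finsupp.linearCombination_single]
  have hA : ((monRepData q).A ^ a) (Finsupp.single (0, b, c, d) 1) =
      Finsupp.single (a, b, c, d) 1 := by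
    induction a with
    | zero => rfl
    | succ d ih =>
      rw [pow_succ', Module.End.mul_apply, ih]
      simp [-Finsupp.smul_single, monRepData, Finsupp.linearCombination_single]
  simp only [mon, map_mul, map_pow, lift_gen, MatData.toFun, Module.End.mul_apply, hD, hC, hB, hA]

/-- The basis of ordered monomials. -/
def monBasis : Module.Basis (ℕ × ℕ × ℕ × ℕ) 𝕜 (GLqPlus q) :=
  .ofRepr <| LinearEquiv.ofLinearMap
    (LinearMap.applyₗ (Finsupp.single 0 1) ∘ₗ (monRepData q).lift.toLinearMap)
    (Finsupp.linearCombination 𝕜 (mon q))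
    (Finsupp.lhom_ext' fun m => LinearMap.ext_ring <| by simp [lift_mon])
    (LinearMap.ext fun x => by
      have h := mul_linearCombination_mon q x (Finsupp.single 0 1)
      simpa [mon] using h.symm)

theorem monBasis_apply (m : ℕ × ℕ × ℕ × ℕ) : monBasis q m = mon q m := by
  change Finsupp.linearCombination 𝕜 (mon q) (Finsupp.single m 1) = _
  simp

end GLqPlus

/-! ### The extension by `δ` -/

/-- Elements of an algebra that satisfy the relations of the extension of `GL_q^+(2)` by `δ`
define a homomorphism out of it. -/
theorem GLqExt.exists_lift (q : 𝕜ˣ) {R : Type*} [Ring R] [Algebra 𝕜 R] (m : MatData q R) (u : Rˣ)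
    (hA : u * m.A = m.A * u) (hB : u * m.B = (q : 𝕜) • (m.B * u))
    (hC : u * m.C = ((q⁻¹ : 𝕜ˣ) : 𝕜) • (m.C * u)) (hD : u * m.D = m.D * u) :
    ∃ φ : GLqExt q →ₐ[𝕜] R, ∀ x, φ (GLqExt.incl q x) = m.lift x := by
  let f : ExtGen → R := fun g => match g with
    | .A => m.A
    | .B => m.B
    | .C => m.C
    | .D => m.D
    | .del => u
    | .delInv => ↑u⁻¹
  let π : FreeAlgebra 𝕜 MatGen →ₐ[𝕜] GLqPlus q := RingQuot.mkAlgHom 𝕜 (MatRel q)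
  have hπ : ∀ g, m.lift (π (FreeAlgebra.ι 𝕜 g)) = m.toFun g := GLqPlus.lift_gen m
  have hf : ∀ x, FreeAlgebra.lift 𝕜 f
      (FreeAlgebra.lift 𝕜 (fun g : MatGen => FreeAlgebra.ι 𝕜 g.toExt) x) = m.lift (π x) := by
    intro x
    induction x using FreeAlgebra.induction with
    | grade0 c => simp only [AlgHom.commutes]
    | grade1 g => rw [hπ]; cases g <;> simp [MatGen.toExt, f, MatData.toFun]
    | add x y h1 h2 => simp only [map_add, h1, h2]
    | mul x y h1 h2 => simp only [map_mul, h1, h2]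
  have hr : ∀ ⦃x y⦄, ExtRel q x y → FreeAlgebra.lift 𝕜 f x = FreeAlgebra.lift 𝕜 f y := by
    intro x y h
    cases h with
    | mat h => rw [hf, hf]; exact congrArg m.lift (RingQuot.mkAlgHom_rel 𝕜 h)
    | del_delInv => simp [f]
    | delInv_del => simp [f]
    | del_A => simpa [f] using hA
    | del_B => simpa [f] using hB
    | del_C => simpa [f] using hC
    | del_D => simpa [f] using hD
  let φ : GLqExt q →ₐ[𝕜] R := RingQuot.liftAlgHom 𝕜 ⟨FreeAlgebra.lift 𝕜 f, hr⟩
  have hφ : ∀ g, φ (GLqExt.gen q g) = f g := fun g =>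
    (RingQuot.liftAlgHom_mkAlgHom_apply _ _ _ _).trans (by simp)
  refine ⟨φ, fun x => ?_⟩
  induction x using GLqPlus.induction with
  | hg g => rw [GLqExt.incl_gen, GLqPlus.lift_gen, hφ]; cases g <;> rfl
  | hc c => simp only [AlgHom.commutes]
  | ha x y h1 h2 => simp only [map_add, h1, h2]
  | hm x y h1 h2 => simp only [map_mul, h1, h2]

/-- The automorphism `torus u w` as an invertible linear map. -/
def torusUnit (q u w : 𝕜ˣ) : (Module.End 𝕜 (GLqPlus q))ˣ where
  val := (GLqPlus.torus q u w).toLinearMap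
  inv := (GLqPlus.torus q u⁻¹ w⁻¹).toLinearMap
  val_inv := LinearMap.ext fun x => by simp [GLqPlus.torus_torus, GLqPlus.torus_one]
  inv_val := LinearMap.ext fun x => by simp [GLqPlus.torus_torus, GLqPlus.torus_one]

/-- The extension acts on `GL_q^+(2)`: the generators of `GL_q^+(2)` by left multiplication and `δ`
by a torus automorphism. Hence `GL_q^+(2)` embeds in the extension. -/
theorem GLqExt.incl_injective (q h : 𝕜ˣ) (hh : h ^ 2 = q) : Function.Injective (incl q) := by
  have hh' : (h : 𝕜) * h = q := by rw [← hh]; push_cast; ring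
  have hh'' : (h : 𝕜)⁻¹ * (h : 𝕜)⁻¹ = (q : 𝕜)⁻¹ := by rw [← hh', mul_inv]
  let d := GLqPlus.genData q
  have hmul : ∀ x y, (LinearMap.mulLeft 𝕜 x * LinearMap.mulLeft 𝕜 y :
      Module.End 𝕜 (GLqPlus q)) = LinearMap.mulLeft 𝕜 (x * y) := fun x y =>
    (LinearMap.mulLeft_mul 𝕜 _ x y).symm
  have hsub : ∀ x y, (LinearMap.mulLeft 𝕜 x - LinearMap.mulLeft 𝕜 y :
      Module.End 𝕜 (GLqPlus q)) = LinearMap.mulLeft 𝕜 (x - y) := fun x y => by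
    ext z; simp [sub_mul]
  have hsmul : ∀ (c : 𝕜) x, (c • LinearMap.mulLeft 𝕜 x :
      Module.End 𝕜 (GLqPlus q)) = LinearMap.mulLeft 𝕜 (c • x) := fun c x => by
    ext z; simp
  let m : MatData q (Module.End 𝕜 (GLqPlus q)) :=
    { A := LinearMap.mulLeft 𝕜 d.A
      B := LinearMap.mulLeft 𝕜 d.B
      C := LinearMap.mulLeft 𝕜 d.C
      D := LinearMap.mulLeft 𝕜 d.D
      A_B := by rw [hmul, hmul, hsmul, d.A_B]
      C_B := by rw [hmul, hmul, d.C_B]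
      D_B := by rw [hmul, hmul, hsmul, d.D_B]
      C_A := by rw [hmul, hmul, hsmul, d.C_A]
      A_D := by rw [hmul, hmul, hmul, hsub, hsmul, d.A_D]
      C_D := by rw [hmul, hmul, hsmul, d.C_D] }
  -- With u = w = h the torus scales A and D by 1, B by h² = q and C by q⁻¹, which are exactly the
  -- commutation factors of δ.
  have ht : ∀ g, ((torusUnit q h h : (Module.End 𝕜 (GLqPlus q))ˣ) : Module.End 𝕜 (GLqPlus q)) *
      LinearMap.mulLeft 𝕜 (GLqPlus.gen q g) = (GLqPlus.weight h h g : 𝕜) •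
        (LinearMap.mulLeft 𝕜 (GLqPlus.gen q g) * (torusUnit q h h : Module.End 𝕜 (GLqPlus q))) := by
    intro g
    ext z
    simp [torusUnit, GLqPlus.torus_gen]
  obtain ⟨φ, hφ⟩ := GLqExt.exists_lift q m (torusUnit q h h)
    ((ht .A).trans (by simp [GLqPlus.weight, m, d, GLqPlus.genData]))
    ((ht .B).trans (by simp [GLqPlus.weight, m, d, GLqPlus.genData, hh']))
    ((ht .C).trans (by simp [GLqPlus.weight, m, d, GLqPlus.genData, hh'']))
    ((ht .D).trans (by simp [GLqPlus.weight, m, d, GLqPlus.genData]))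
  have hm : ∀ x y, m.lift x y = x * y := by
    intro x
    induction x using GLqPlus.induction with
    | hg g => intro y; rw [GLqPlus.lift_gen]; cases g <;> rfl
    | hc c => intro y; simp [Algebra.smul_def]
    | ha x x' h1 h2 => intro y; simp [h1, h2, add_mul]
    | hm x x' h1 h2 => intro y; simp [h1, h2, mul_assoc]
  -- The image of x acts as left multiplication by x, so its value at 1 recovers x.
  intro x y hxy
  have h1 := congrArg (fun z => φ z 1) hxy
  simpa [hφ, hm] using h1

namespace GLqPlus

variable (q : 𝕜ˣ)

/-! ### Products of rows

The coefficients with respect to `s` of a product of factors `x s + q ^ n y`, where `(x, y)` is the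
row `(A, C)` or `(B, D)`, are recorded as a function on `ℤ`. -/

/-- The coefficients of `(x s + q ^ n y) f`. -/
def row (x y : GLqPlus q) (n : ℕ) (f : ℤ → GLqPlus q) (m : ℤ) : GLqPlus q :=
  x * f (m - 1) + (q : 𝕜) ^ n • (y * f m)

/-- The coefficients of `(B s + q ^ (n - 1) D) ⋯ (B s + D)`. -/
def rowProd : ℕ → ℤ → GLqPlus q
  | 0 => Pi.single 0 1
  | n + 1 => row q (gen q .B) (gen q .D) n (rowProd n)

/-- The coefficients of
`(A s + q ^ (b + a - 1) C) ⋯ (A s + q ^ b C) (B s + q ^ (b - 1) D) ⋯ (B s + D)`. -/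
def chain (b : ℕ) : ℕ → ℤ → GLqPlus q
  | 0 => rowProd q b
  | a + 1 => row q (gen q .A) (gen q .C) (b + a) (chain b a)

theorem rowProd_eq_zero_of_lt {n : ℕ} {m : ℤ} (h : n < m) : rowProd q n m = 0 := by
  induction n generalizing m with
  | zero => simp [rowProd, show m ≠ 0 by rintro rfl; simp at h]
  | succ n ih =>
    rw [rowProd, row, ih (by push_cast at h; omega), ih (by push_cast at h; omega)]
    simp

theorem rowProd_eq_zero_of_neg (n : ℕ) {m : ℤ} (h : m < 0) : rowProd q n m = 0 := by
  induction n generalizing m with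
  | zero => simp [rowProd, h.ne]
  | succ n ih =>
    rw [rowProd, row, ih (by omega), ih (by omega)]
    simp

/-- Places the power B^n in the family `rowProd`; this is the vector from which the F̄-ladder
starts. -/
theorem rowProd_self (n : ℕ) : rowProd q n n = gen q .B ^ n := by
  induction n with
  | zero => simp [rowProd]
  | succ n ih =>
    have h0 : rowProd q n (n + 1 : ℕ) = 0 := rowProd_eq_zero_of_lt q (by push_cast; omega)
    rw [rowProd, row, h0, show ((n + 1 : ℕ) : ℤ) - 1 = n by push_cast; ring, ih, pow_succ']
    simp

/-- The entries x and y of a row differ in weight by w², and the shift by one in the power of s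
compensates for this, so both terms of `row` have the same weight. -/
theorem torus_row {x y : GLqPlus q} {u w c : 𝕜ˣ}
    (hx : torus q u w x = ((c * w : 𝕜ˣ) : 𝕜) • x) (hy : torus q u w y = ((c * w⁻¹ : 𝕜ˣ) : 𝕜) • y)
    {v : 𝕜ˣ} {N : ℕ} {f : ℤ → GLqPlus q}
    (hf : ∀ m, torus q u w (f m) = ((v * w ^ (2 * m - N) : 𝕜ˣ) : 𝕜) • f m) (n : ℕ) (m : ℤ) :
    torus q u w (row q x y n f m) =
      ((c * v * w ^ (2 * m - (N + 1 : ℕ)) : 𝕜ˣ) : 𝕜) • row q x y n f m := by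
  have h1 : c * w * (v * w ^ (2 * (m - 1) - N)) = c * v * w ^ (2 * m - (N + 1 : ℕ)) := by
    rw [show 2 * m - ((N + 1 : ℕ) : ℤ) = 1 + (2 * (m - 1) - N) by push_cast; ring, zpow_add,
      zpow_one, mul_mul_mul_comm]
  have h2 : c * w⁻¹ * (v * w ^ (2 * m - N)) = c * v * w ^ (2 * m - (N + 1 : ℕ)) := by
    rw [show 2 * m - ((N + 1 : ℕ) : ℤ) = -1 + (2 * m - N) by push_cast; ring, zpow_add,
      zpow_neg_one, mul_mul_mul_comm]
  simp only [row, map_add, map_mul, map_smul, hx, hy, hf, smul_mul_smul_comm, ← Units.val_mul, h1,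
    h2, smul_add, smul_comm ((q : 𝕜) ^ n)]

theorem torus_rowProd (u w : 𝕜ˣ) (n : ℕ) (m : ℤ) : torus q u w (rowProd q n m) =
    ((u ^ n * w ^ (2 * m - n) : 𝕜ˣ) : 𝕜) • rowProd q n m := by
  induction n generalizing m with
  | zero =>
    by_cases h : m = 0
    · simp [rowProd, h]
    · simp [rowProd, h]
  | succ n ih =>
    rw [pow_succ']
    exact torus_row q (torus_gen q u w .B) (torus_gen q u w .D) ih n m

theorem torus_chain (u w : 𝕜ˣ) (b a : ℕ) (m : ℤ) : torus q u w (chain q b a m) =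
    ((u ^ ((b : ℤ) - a) * w ^ (2 * m - (b + a : ℕ)) : 𝕜ˣ) : 𝕜) • chain q b a m := by
  induction a generalizing m with
  | zero => simp [chain, torus_rowProd]
  | succ a ih =>
    rw [show (b : ℤ) - (a + 1 : ℕ) = -1 + (b - a) by push_cast; ring, zpow_add, zpow_neg_one]
    exact torus_row q (torus_gen q u w .A) (torus_gen q u w .C) ih (b + a) m

/-- The two rows commute up to a power of `q`. -/
theorem row_row (n : ℕ) (f : ℤ → GLqPlus q) (m : ℤ) :
    row q (gen q .B) (gen q .D) (n + 1) (row q (gen q .A) (gen q .C) n f) m =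
      (q : 𝕜) • row q (gen q .A) (gen q .C) (n + 1) (row q (gen q .B) (gen q .D) n f) m := by
  simp only [row, mul_add, mul_smul_comm, ← mul_assoc, BA, DC, DA, CB, sub_mul, smul_mul_assoc]
  simp only [Units.val_inv_eq_inv_val]
  match_scalars <;> field_simp <;> ring

theorem row_smul (x y : GLqPlus q) (n : ℕ) (c : 𝕜) (f : ℤ → GLqPlus q) (m : ℤ) :
    row q x y n (fun i => c • f i) m = c • row q x y n f m := by
  simp only [row, mul_smul_comm, smul_add, smul_comm c]

theorem leftF_row_A (n : ℕ) (f : ℤ → GLqPlus q) (m : ℤ) :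
    (leftFData q).der (row q (gen q .A) (gen q .C) n f m) =
      row q (gen q .A) (gen q .C) n (fun i => (leftFData q).der (f i)) m := by
  simp [row, SkewData.der_mul, SkewData.der_gen, SkewData.toFun, leftFData]

theorem leftF_row_B (n : ℕ) (f : ℤ → GLqPlus q) (m : ℤ) :
    (leftFData q).der (row q (gen q .B) (gen q .D) n f m) =
      row q (gen q .B) (gen q .D) n (fun i => (leftFData q).der (f i)) m +
      row q (gen q .A) (gen q .C) n (fun i => torus q q⁻¹ 1 (f i)) m := by
  simp [row, SkewData.der_mul, SkewData.der_gen, SkewData.toFun, leftFData]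
  abel

variable {q} in
theorem qInt_succ (hq : (q : 𝕜) - ((q⁻¹ : 𝕜ˣ) : 𝕜) ≠ 0) (n : ℕ) :
    qInt q (n + 1 : ℕ) = (q : 𝕜) * qInt q n + ((q⁻¹ ^ n : 𝕜ˣ) : 𝕜) := by
  unfold qInt
  rw [eq_comm, mul_div_assoc', div_add' _ _ _ hq]
  congr 1
  rw [zpow_neg, zpow_neg, zpow_natCast, zpow_natCast, inv_pow]
  push_cast
  field_simp
  ring

/-- `F` replaces one row `(B, D)` by a row `(A, C)`. -/
theorem leftF_rowProd (hq : (q : 𝕜) - ((q⁻¹ : 𝕜ˣ) : 𝕜) ≠ 0) (n : ℕ) (m : ℤ) :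
    (leftFData q).der (rowProd q (n + 1) m) = qInt q (n + 1 : ℕ) • chain q n 1 m := by
  induction n generalizing m with
  | zero =>
    rw [rowProd, leftF_row_B, chain, chain]
    have h0 : ∀ i, (leftFData q).der (rowProd q 0 i) = 0 := fun i => by
      by_cases h : i = 0
      · subst h; simpa [rowProd] using (leftFData q).der_algebraMap 1
      · simp [rowProd, h]
    have h1 : qInt q 1 = 1 := by simpa [qInt] using div_self hq
    simp [torus_rowProd, h0, h1]
    simp [row]
  | succ n ih =>
    -- F on the front row leaves q^{-H} on the n + 1 remaining rows, a factor q^(-(n+1)). F on the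
    -- remaining rows gives [n+1] and a row (A, C) just behind the front row, which `row_row` moves
    -- forward at the cost of q. The total is q [n+1] + q^(-(n+1)) = [n+2].
    rw [rowProd, leftF_row_B, funext ih, funext (torus_rowProd q q⁻¹ 1 (n + 1)), row_smul,
      funext (show ∀ m, chain q n 1 m = row q (gen q .A) (gen q .C) n (rowProd q n) m from
        fun _ => rfl), row_row, chain, chain, rowProd, qInt_succ hq (n + 1)]
    simp only [one_zpow, mul_one, row_smul, add_zero, add_smul, mul_smul]
    rw [smul_comm]

/-- F annihilates A and C, so it passes through the rows (A, C) and acts on the innermost product of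
rows (B, D). The exponents of the outer rows stay correct because the total number of rows does not
change. -/
theorem leftF_chain (hq : (q : 𝕜) - ((q⁻¹ : 𝕜ˣ) : 𝕜) ≠ 0) (b a : ℕ) (m : ℤ) :
    (leftFData q).der (chain q (b + 1) a m) = qInt q (b + 1 : ℕ) • chain q b (a + 1) m := by
  induction a generalizing m with
  | zero => exact leftF_rowProd q hq b m
  | succ a ih =>
    rw [chain, leftF_row_A, funext ih, row_smul]
    conv_rhs => rw [chain]
    rw [show b + 1 + a = b + (a + 1) by ring]

theorem leftF_chain_zero (a : ℕ) (m : ℤ) : (leftFData q).der (chain q 0 a m) = 0 := by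
  induction a generalizing m with
  | zero =>
    rw [chain, rowProd]
    by_cases h : m = 0
    · subst h; simpa using (leftFData q).der_algebraMap 1
    · simp [h]
  | succ a ih =>
    rw [chain, leftF_row_A, funext ih]
    simp [row]

/-- F̄ turns x into y and kills y, so it trades one power of s for the other entry of a row. The
scalar is a quantum integer up to a power of q, kept free of denominators by the factor 1 - q⁻². The
induction step is the identity (1 - q⁻²) q^(2(m-1)-n) + q^n (1 - q^(2(m-1-n))) = q^n (1 -
q^(2(m-2-n))). -/
theorem rightF_row {x y : GLqPlus q} (hx : (rightFData q).der x = y)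
    (hy : (rightFData q).der y = 0) {n : ℕ} {f : ℤ → GLqPlus q}
    (ht : ∀ m, torus q 1 q (f m) = ((q ^ (2 * m - n) : 𝕜ˣ) : 𝕜) • f m)
    (hf : ∀ m, (1 - (q : 𝕜)⁻¹ ^ 2) • (rightFData q).der (f m) =
      (1 - (q : 𝕜) ^ (2 * (m - 1 - n))) • f (m - 1)) (m : ℤ) :
    (1 - (q : 𝕜)⁻¹ ^ 2) • (rightFData q).der (row q x y n f m) =
      (1 - (q : 𝕜) ^ (2 * (m - 1 - (n + 1 : ℕ)))) • row q x y n f (m - 1) := by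
  have hq : (q : 𝕜) ≠ 0 := q.ne_zero
  simp only [row, map_add, map_smul, SkewData.der_mul, hx, hy, AlgHom.id_apply, zero_mul, add_zero,
    ht, smul_add]
  rw [← mul_smul_comm, hf, smul_comm _ ((q : 𝕜) ^ n), ← mul_smul_comm _ y ((rightFData q).der _), hf]
  simp only [mul_smul_comm, smul_smul]
  match_scalars
  · rw [show 2 * (m - 1 - 1 - (n : ℤ)) = 2 * (m - 1 - (n + 1 : ℕ)) by push_cast; ring]
    simp only [Nat.cast_add, Nat.cast_one]
  · rw [show 2 * (m - 1) - (n : ℤ) = n + 2 * (m - 1 - n) by ring,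
      show 2 * (m - 1 - ((n : ℤ) + 1)) = 2 * (m - 1 - n) - 2 by ring, zpow_add₀ hq, zpow_sub₀ hq,
      zpow_natCast]
    simp only [zpow_ofNat]
    field_simp
    ring

theorem rightF_one : (rightFData q).der 1 = 0 := by
  simpa using (rightFData q).der_algebraMap 1

theorem rightF_rowProd (n : ℕ) (m : ℤ) :
    (1 - (q : 𝕜)⁻¹ ^ 2) • (rightFData q).der (rowProd q n m) =
      (1 - (q : 𝕜) ^ (2 * (m - 1 - n))) • rowProd q n (m - 1) := by
  induction n generalizing m with
  | zero =>
    simp only [rowProd]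
    by_cases h : m = 0
    · subst h; simp [rightF_one]
    · by_cases h' : m - 1 = 0
      · simp [h, h']
      · simp [h, h']
  | succ n ih =>
    refine rightF_row q ?_ ?_ (fun m => ?_) ih m
    · rw [SkewData.der_gen]; rfl
    · rw [SkewData.der_gen]; rfl
    · rw [torus_rowProd]; simp

end GLqPlus

namespace GLqPlus

/-! ### The quantum determinant -/

/-- An element killed by d and fixed by f behaves as a constant on the left in the skew Leibniz
rule. -/
theorem SkewData.der_pow_mul {q : 𝕜ˣ} {f g : GLqPlus q →ₐ[𝕜] GLqPlus q} (d : SkewData q f g)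
    {z : GLqPlus q} (hz : d.der z = 0) (hf : f z = z) (n : ℕ) (x : GLqPlus q) :
    d.der (z ^ n * x) = z ^ n * d.der x := by
  induction n with
  | zero => simp
  | succ n ih => rw [pow_succ', mul_assoc, d.der_mul, hz, hf, ih, zero_mul, add_zero, mul_assoc]

variable (q : 𝕜ˣ)

/-- The quantum determinant `A D - q⁻¹ B C`. -/
def qdet : GLqPlus q := gen q .A * gen q .D - ((q⁻¹ : 𝕜ˣ) : 𝕜) • (gen q .B * gen q .C)

/-- Together with the vanishing of E, F, Ē, F̄ on `qdet`, this makes left multiplication by `qdet q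
^ j` commute with both actions except for I and Ī, whose eigenvalue it raises by 2j. This is how the
case j = 0 yields all j. -/
theorem torus_qdet (u w : 𝕜ˣ) : torus q u w (qdet q) = qdet q := by
  simp only [qdet, map_sub, map_smul, map_mul, torus_gen, smul_mul_smul_comm, ← Units.val_mul,
    weight]
  rw [show u⁻¹ * w * (u * w⁻¹) = 1 by rw [mul_mul_mul_comm]; simp,
    show u * w * (u⁻¹ * w⁻¹) = 1 by rw [mul_mul_mul_comm]; simp]
  simp

theorem leftE_qdet : (leftEData q).der (qdet q) = 0 := by
  simp [qdet, SkewData.der_mul, SkewData.der_gen, SkewData.toFun, leftEData, torus_gen, weight,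
    smul_smul]

theorem leftF_qdet : (leftFData q).der (qdet q) = 0 := by
  simp [qdet, SkewData.der_mul, SkewData.der_gen, SkewData.toFun, leftFData, torus_gen, weight,
    smul_smul]

theorem rightE_qdet : (rightEData q).der (qdet q) = 0 := by
  simp [qdet, SkewData.der_mul, SkewData.der_gen, SkewData.toFun, rightEData, torus_gen, weight,
    smul_smul, BA]

theorem rightF_qdet : (rightFData q).der (qdet q) = 0 := by
  simp [qdet, SkewData.der_mul, SkewData.der_gen, SkewData.toFun, rightFData, torus_gen, weight,
    smul_smul, DC]

theorem leftE_qdet_pow_mul (n : ℕ) (x : GLqPlus q) :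
    (leftEData q).der (qdet q ^ n * x) = qdet q ^ n * (leftEData q).der x :=
  SkewData.der_pow_mul _ (leftE_qdet q) (torus_qdet q _ _) n x

theorem leftF_qdet_pow_mul (n : ℕ) (x : GLqPlus q) :
    (leftFData q).der (qdet q ^ n * x) = qdet q ^ n * (leftFData q).der x :=
  SkewData.der_pow_mul _ (leftF_qdet q) rfl n x

theorem rightE_qdet_pow_mul (n : ℕ) (x : GLqPlus q) :
    (rightEData q).der (qdet q ^ n * x) = qdet q ^ n * (rightEData q).der x :=
  SkewData.der_pow_mul _ (rightE_qdet q) (torus_qdet q _ _) n x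

theorem rightF_qdet_pow_mul (n : ℕ) (x : GLqPlus q) :
    (rightFData q).der (qdet q ^ n * x) = qdet q ^ n * (rightFData q).der x :=
  SkewData.der_pow_mul _ (rightF_qdet q) rfl n x

theorem torus_qdet_pow_mul (u w : 𝕜ˣ) (n : ℕ) (x : GLqPlus q) :
    torus q u w (qdet q ^ n * x) = qdet q ^ n * torus q u w x := by
  rw [map_mul, map_pow, torus_qdet]

/-! ### The action on ordered monomials -/

variable {q} in
theorem deg_mul {x y : GLqPlus q} {a b : 𝕜} (hx : (degData q).der x = a • x)
    (hy : (degData q).der y = b • y) : (degData q).der (x * y) = (a + b) • (x * y) := by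
  rw [SkewData.der_mul, hx, hy, AlgHom.id_apply, AlgHom.id_apply, mul_smul_comm, smul_mul_assoc,
    ← add_smul, add_comm]

variable {q} in
theorem deg_pow {x : GLqPlus q} {a : 𝕜} (hx : (degData q).der x = a • x) (n : ℕ) :
    (degData q).der (x ^ n) = (n * a) • x ^ n := by
  induction n with
  | zero => simpa using (degData q).der_algebraMap 1
  | succ n ih => rw [pow_succ, deg_mul ih hx]; congr 1; push_cast; ring

theorem deg_gen (g : MatGen) : (degData q).der (gen q g) = (1 : 𝕜) • gen q g := by
  rw [SkewData.der_gen, one_smul]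
  cases g <;> rfl

theorem deg_qdet : (degData q).der (qdet q) = (2 : 𝕜) • qdet q := by
  rw [qdet, map_sub, map_smul, deg_mul (deg_gen q _) (deg_gen q _),
    deg_mul (deg_gen q _) (deg_gen q _), smul_sub, smul_comm, one_add_one_eq_two]

theorem deg_mon (m : ℕ × ℕ × ℕ × ℕ) : (degData q).der (mon q m) =
    ((m.1 + m.2.1 + m.2.2.1 + m.2.2.2 : ℕ) : 𝕜) • mon q m := by
  rw [mon, deg_mul (deg_mul (deg_mul (deg_pow (deg_gen q _) _) (deg_pow (deg_gen q _) _))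
    (deg_pow (deg_gen q _) _)) (deg_pow (deg_gen q _) _)]
  simp

theorem torus_mon (u w : 𝕜ˣ) (m : ℕ × ℕ × ℕ × ℕ) : torus q u w (mon q m) =
    ((u ^ ((m.2.1 + m.2.2.2 : ℤ) - m.1 - m.2.2.1) *
      w ^ ((m.1 + m.2.1 : ℤ) - m.2.2.1 - m.2.2.2) : 𝕜ˣ) : 𝕜) • mon q m := by
  simp only [mon, map_mul, map_pow, torus_gen, smul_pow, smul_mul_smul_comm, ← Units.val_mul,
    ← Units.val_pow_eq_pow_val, weight]
  congr 2
  simp only [zpow_sub, zpow_add, zpow_natCast, mul_pow, inv_pow]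
  ext
  push_cast
  field_simp

variable {q} in
theorem qInt_succ' (hq : (q : 𝕜) - ((q⁻¹ : 𝕜ˣ) : 𝕜) ≠ 0) (n : ℕ) :
    qInt q (n + 1 : ℕ) = (q : 𝕜)⁻¹ * qInt q n + (q : 𝕜) ^ n := by
  unfold qInt
  rw [eq_comm, mul_div_assoc', div_add' _ _ _ hq]
  congr 1
  rw [zpow_neg, zpow_neg, zpow_natCast, zpow_natCast]
  push_cast
  field_simp
  ring

/-- In E(x · xⁿ) the weight of x contributes q⁻¹ [n], and moving y past xⁿ contributes qⁿ; their sum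
is [n+1]. It applies to the pairs (A, B) and (C, D). -/
theorem leftE_pow (hq : (q : 𝕜) - ((q⁻¹ : 𝕜ˣ) : 𝕜) ≠ 0) {x y : GLqPlus q}
    (hx : (leftEData q).der x = y) (ht : torus q q 1 x = ((q⁻¹ : 𝕜ˣ) : 𝕜) • x)
    (hyx : y * x = (q : 𝕜) • (x * y)) (n : ℕ) :
    (leftEData q).der (x ^ n) = qInt q n • (x ^ (n - 1) * y) := by
  induction n with
  | zero => simpa [qInt] using (leftEData q).der_algebraMap 1
  | succ n ih =>
    rw [pow_succ', SkewData.der_mul, ih, hx, ht, AlgHom.id_apply, mul_pow_of_skew hyx,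
      qInt_succ' hq, smul_mul_smul_comm, ← mul_assoc, Nat.add_sub_cancel, add_smul]
    rcases n with _ | n
    · simp [qInt]
    · rw [Nat.add_sub_cancel, ← pow_succ', Units.val_inv_eq_inv_val]

theorem SkewData.der_pow_eq_zero {q : 𝕜ˣ} {f g : GLqPlus q →ₐ[𝕜] GLqPlus q} (d : SkewData q f g)
    {x : GLqPlus q} (hx : d.der x = 0) (n : ℕ) : d.der (x ^ n) = 0 := by
  induction n with
  | zero => simpa using d.der_algebraMap 1
  | succ n ih => rw [pow_succ, der_mul, ih, hx, mul_zero, zero_mul, add_zero]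

/-- Only the powers of A and C contribute. The factor q^(b-a) is the weight of A^a B^b, which stands
in front of the power of C. -/
theorem leftE_mon (hq : (q : 𝕜) - ((q⁻¹ : 𝕜ˣ) : 𝕜) ≠ 0) (a b c d : ℕ) :
    (leftEData q).der (mon q (a, b, c, d)) = qInt q a • mon q (a - 1, b + 1, c, d) +
      (((q ^ ((b : ℤ) - a) : 𝕜ˣ) : 𝕜) * qInt q c) • mon q (a, b, c - 1, d + 1) := by
  have hA : (leftEData q).der (gen q .A ^ a) = qInt q a • (gen q .A ^ (a - 1) * gen q .B) :=
    leftE_pow q hq ((leftEData q).der_gen .A) (by simp [torus_gen, weight]) (BA q) a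
  have hC : (leftEData q).der (gen q .C ^ c) = qInt q c • (gen q .C ^ (c - 1) * gen q .D) :=
    leftE_pow q hq ((leftEData q).der_gen .C) (by simp [torus_gen, weight]) (DC q) c
  have hB : (leftEData q).der (gen q .B ^ b) = 0 :=
    (leftEData q).der_pow_eq_zero ((leftEData q).der_gen .B) b
  have hD : (leftEData q).der (gen q .D ^ d) = 0 :=
    (leftEData q).der_pow_eq_zero ((leftEData q).der_gen .D) d
  have ht : torus q q 1 (gen q .A ^ a * gen q .B ^ b) =
      ((q ^ ((b : ℤ) - a) : 𝕜ˣ) : 𝕜) • (gen q .A ^ a * gen q .B ^ b) := by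
    simpa [mon] using torus_mon q q 1 (a, b, 0, 0)
  simp only [mon, SkewData.der_mul, hA, hB, hC, hD, ht, AlgHom.id_apply, mul_zero, zero_add]
  simp only [smul_mul_assoc, mul_smul_comm, smul_smul, mul_assoc, add_mul, ← pow_succ']
  rw [add_comm, mul_comm (qInt q c)]

/-! ### Highest weight vectors -/

/-- A coefficient of `E x` with respect to the ordered monomials. -/
theorem repr_leftE (hq : (q : 𝕜) - ((q⁻¹ : 𝕜ˣ) : 𝕜) ≠ 0) (x : GLqPlus q) (a b c d : ℕ) :
    (monBasis q).repr ((leftEData q).der x) (a, b + 1, c, d + 1) =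
      qInt q (a + 1 : ℕ) * (monBasis q).repr x (a + 1, b, c, d + 1) +
      ((q ^ ((b + 1 : ℕ) - (a : ℤ)) : 𝕜ˣ) : 𝕜) * qInt q (c + 1 : ℕ) *
        (monBasis q).repr x (a, b + 1, c + 1, d) := by
  have h0 : qInt q 0 = 0 := by simp [qInt]
  induction (monBasis q).mem_span x using Submodule.span_induction with
  | zero => simp
  | add x y _ _ h1 h2 => simp only [map_add, Finsupp.add_apply, h1, h2]; ring
  | smul r x _ h1 => simp only [map_smul, Finsupp.smul_apply, h1, smul_eq_mul]; ring
  | mem x hx =>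
    obtain ⟨⟨a', b', c', d'⟩, rfl⟩ := hx
    rw [monBasis_apply, leftE_mon q hq, map_add, map_smul, map_smul]
    simp only [← monBasis_apply, Module.Basis.repr_self, Finsupp.add_apply, Finsupp.smul_apply,
      Finsupp.single_apply, smul_eq_mul, Prod.mk.injEq]
    congr 1
    · rcases a' with _ | a'
      · simp [h0]
      · simp only [Nat.add_sub_cancel, Nat.add_right_cancel_iff]
        split_ifs with h
        · rw [h.1]
        · simp
    · rcases c' with _ | c'
      · simp [h0]
      · simp only [Nat.add_sub_cancel, Nat.add_right_cancel_iff]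
        split_ifs with h
        · rw [h.1, h.2.1, h.2.2.1]
        · simp

/-- Compare the i-th coordinates of both sides of the eigenvalue equation. Weights and degree
thereby restrict the monomials that can occur in a highest weight vector. -/
theorem repr_eq_zero_of_eigen {ι R M : Type*} [Field R] [AddCommGroup M] [Module R M]
    (b : Module.Basis ι R M) (T : M →ₗ[R] M) {c : ι → R} (hT : ∀ i, T (b i) = c i • b i) {x : M}
    {a : R} (hx : T x = a • x) {i : ι} (hi : c i ≠ a) : b.repr x i = 0 := by
  have h : b.repr (T x) i = c i * b.repr x i := by
    have : b.coord i ∘ₗ T = c i • b.coord i := by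
      refine b.ext fun k => ?_
      by_cases hk : k = i
      · subst hk; simp [hT]
      · simp [hT, hk]
    exact LinearMap.congr_fun this x
  rw [hx, map_smul, Finsupp.smul_apply, smul_eq_mul] at h
  have : (c i - a) * b.repr x i = 0 := by rw [sub_mul, h, sub_self]
  exact (mul_eq_zero.1 this).resolve_left (sub_ne_zero.2 hi)

end GLqPlus

-- Consequences of q not being a root of unity

theorem zpow_inj_of_not_root {q : 𝕜ˣ} (hq : ∀ n : ℕ, 0 < n → q ^ n ≠ 1) {a b : ℤ}
    (h : q ^ a = q ^ b) : a = b := by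
  refine injective_zpow_iff_not_isOfFinOrder.2 ?_ h
  rw [isOfFinOrder_iff_pow_eq_one]
  rintro ⟨n, hn, h⟩
  exact hq n hn h

theorem sub_inv_ne_zero {q : 𝕜ˣ} (hq : ∀ n : ℕ, 0 < n → q ^ n ≠ 1) :
    (q : 𝕜) - ((q⁻¹ : 𝕜ˣ) : 𝕜) ≠ 0 := by
  intro h
  have h1 : q ^ (1 : ℤ) = q ^ (-1 : ℤ) := by
    ext; simpa using sub_eq_zero.1 h
  have := zpow_inj_of_not_root hq h1
  omega

theorem qInt_ne_zero {q : 𝕜ˣ} (hq : ∀ n : ℕ, 0 < n → q ^ n ≠ 1) {n : ℤ} (hn : n ≠ 0) :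
    qInt q n ≠ 0 := by
  refine div_ne_zero (fun h => hn ?_) (sub_inv_ne_zero hq)
  have h1 : q ^ n = q ^ (-n) := Units.ext (sub_eq_zero.1 h)
  have := zpow_inj_of_not_root hq h1
  omega

namespace GLqPlus

variable {q : 𝕜ˣ}

/-- The weight conditions force d = a and b = l + c, and the degree then forces a + c = j;
characteristic zero lets the degree be read off as an integer. So x lies in the span of A^(j-n)
B^(l+n) C^n D^(j-n) for 0 ≤ n ≤ j. The equation E x = 0 links consecutive coefficients, so all of
them vanish with the coefficient for n = 0. -/
theorem eq_zero_of_highestWeight [CharZero 𝕜] (hq : ∀ n : ℕ, 0 < n → q ^ n ≠ 1) {l j : ℕ}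
    {x : GLqPlus q} (hE : (leftEData q).der x = 0)
    (hK : torus q q 1 x = ((q ^ (l : ℤ) : 𝕜ˣ) : 𝕜) • x)
    (hK' : torus q 1 q⁻¹ x = ((q⁻¹ ^ (l : ℤ) : 𝕜ˣ) : 𝕜) • x)
    (hI : (degData q).der x = ((l + 2 * j : ℕ) : 𝕜) • x)
    (h0 : (monBasis q).repr x (j, l, 0, j) = 0) : x = 0 := by
  have hw : ∀ a b c d, (monBasis q).repr x (a, b, c, d) ≠ 0 →
      a ≤ j ∧ b = l + (j - a) ∧ c = j - a ∧ d = a := by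
    intro a b c d h
    have h1 : ((b + d : ℤ) - a - c) = l := by
      by_contra hne
      refine h (repr_eq_zero_of_eigen (monBasis q) (torus q q 1).toLinearMap
        (c := fun m => ((q ^ ((m.2.1 + m.2.2.2 : ℤ) - m.1 - m.2.2.1) : 𝕜ˣ) : 𝕜))
        (fun m => ?_) hK fun h => hne (zpow_inj_of_not_root hq (Units.ext h)))
      rw [monBasis_apply, AlgHom.toLinearMap_apply, torus_mon]
      simp
    have h2 : ((a + b : ℤ) - c - d) = l := by
      by_contra hne
      refine h (repr_eq_zero_of_eigen (monBasis q) (torus q 1 q⁻¹).toLinearMap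
        (c := fun m => ((q⁻¹ ^ ((m.1 + m.2.1 : ℤ) - m.2.2.1 - m.2.2.2) : 𝕜ˣ) : 𝕜))
        (fun m => ?_) hK' fun h => hne (zpow_inj_of_not_root hq (inv_injective ?_)))
      · rw [monBasis_apply, AlgHom.toLinearMap_apply, torus_mon]
        simp
      · rw [← inv_zpow, ← inv_zpow]; exact Units.ext h
    have h3 : a + b + c + d = l + 2 * j := by
      by_contra hne
      refine h (repr_eq_zero_of_eigen (monBasis q) (degData q).der
        (c := fun m => ((m.1 + m.2.1 + m.2.2.1 + m.2.2.2 : ℕ) : 𝕜))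
        (fun m => ?_) hI fun h => hne (Nat.cast_injective h))
      rw [monBasis_apply, deg_mon]
    omega
  have hc : ∀ n ≤ j, (monBasis q).repr x (j - n, l + n, n, j - n) = 0 := by
    intro n hn
    induction n with
    | zero => simpa using h0
    | succ n ih =>
      -- The coefficient of E x at (j-n-1, l+n+1, n, j-n) involves only the candidates with indices
      -- n and n + 1.
      have h := repr_leftE q (sub_inv_ne_zero hq) x (j - (n + 1)) (l + n) n (j - (n + 1))
      rw [hE, show j - (n + 1) + 1 = j - n by omega, ih (by omega), map_zero, Finsupp.zero_apply,
        mul_zero, zero_add, eq_comm] at h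
      refine (mul_eq_zero.1 h).resolve_left (mul_ne_zero (Units.ne_zero _) ?_)
      exact qInt_ne_zero hq (by omega)
  refine (monBasis q).repr.map_eq_zero_iff.1 (Finsupp.ext fun ⟨a, b, c, d⟩ => ?_)
  by_contra hne
  obtain ⟨h1, h2, h3, h4⟩ := hw a b c d hne
  have := hc (j - a) (by omega)
  rw [show j - (j - a) = a by omega] at this
  subst h2 h3 h4
  exact hne this

/-- Highest weight vectors of a given weight and degree are proportional. -/
theorem exists_eq_smul_of_highestWeight [CharZero 𝕜] (hq : ∀ n : ℕ, 0 < n → q ^ n ≠ 1) {l j : ℕ}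
    {x y : GLqPlus q} (hE : (leftEData q).der x = 0)
    (hK : torus q q 1 x = ((q ^ (l : ℤ) : 𝕜ˣ) : 𝕜) • x)
    (hK' : torus q 1 q⁻¹ x = ((q⁻¹ ^ (l : ℤ) : 𝕜ˣ) : 𝕜) • x)
    (hI : (degData q).der x = ((l + 2 * j : ℕ) : 𝕜) • x) (hyE : (leftEData q).der y = 0)
    (hyK : torus q q 1 y = ((q ^ (l : ℤ) : 𝕜ˣ) : 𝕜) • y)
    (hyK' : torus q 1 q⁻¹ y = ((q⁻¹ ^ (l : ℤ) : 𝕜ˣ) : 𝕜) • y)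
    (hyI : (degData q).der y = ((l + 2 * j : ℕ) : 𝕜) • y) (hy : y ≠ 0) : ∃ c : 𝕜, x = c • y := by
  set m : ℕ × ℕ × ℕ × ℕ := (j, l, 0, j)
  have h0 : (monBasis q).repr y m ≠ 0 := fun h =>
    hy (eq_zero_of_highestWeight hq hyE hyK hyK' hyI h)
  refine ⟨(monBasis q).repr x m / (monBasis q).repr y m, sub_eq_zero.1 <|
    eq_zero_of_highestWeight hq (l := l) (j := j) ?_ ?_ ?_ ?_ ?_⟩
  · rw [map_sub, map_smul, hE, hyE, smul_zero, sub_zero]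
  · rw [map_sub, map_smul, hK, hyK, smul_sub, smul_comm]
  · rw [map_sub, map_smul, hK', hyK', smul_sub, smul_comm]
  · rw [map_sub, map_smul, hI, hyI, smul_sub, smul_comm]
  · rw [map_sub, map_smul, Finsupp.sub_apply, Finsupp.smul_apply, smul_eq_mul,
      div_mul_cancel₀ _ h0, sub_self]

-- Nonvanishing of the highest weight vectors

variable (q)

/-- The action of `GL_q^+(2)` on functions on `ℤ` in which `C = 0`, `B` shifts, and `A` and `D` are
mutually inverse diagonal operators. -/
def shiftData : MatData q (Module.End 𝕜 (ℤ → 𝕜)) where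
  A := LinearMap.pi fun n => ((q ^ (-n) : 𝕜ˣ) : 𝕜) • LinearMap.proj n
  B := LinearMap.pi fun n => LinearMap.proj (n - 1)
  C := 0
  D := LinearMap.pi fun n => ((q ^ n : 𝕜ˣ) : 𝕜) • LinearMap.proj n
  A_B := by
    refine LinearMap.ext fun f => funext fun n => ?_
    have hq : (q : 𝕜) ≠ 0 := q.ne_zero
    simp [zpow_sub₀ hq]
    field_simp
  C_B := by simp
  D_B := by
    refine LinearMap.ext fun f => funext fun n => ?_
    have hq : (q : 𝕜) ≠ 0 := q.ne_zero
    simp [zpow_sub₀ hq]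
    field_simp
  C_A := by simp
  A_D := by
    refine LinearMap.ext fun f => funext fun n => ?_
    simp
    field_simp
    ring
  C_D := by simp

/-- In the representation on functions on ℤ, C = 0 and A D = 1, so `qdet` acts as the identity,
while B is a shift and fixes the constant function 1. The product therefore fixes a nonzero vector.
-/
theorem qdet_pow_mul_B_pow_ne_zero (j l : ℕ) : qdet q ^ j * gen q .B ^ l ≠ 0 := by
  have h1 : (shiftData q).lift (qdet q) = 1 := by
    simp only [qdet, map_sub, map_mul, map_smul, lift_gen, MatData.toFun]
    refine LinearMap.ext fun f => funext fun n => ?_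
    simp [shiftData]
    field_simp
  have h2 : ∀ l : ℕ, ((shiftData q).B ^ l) (fun _ => 1) = fun _ => 1 := by
    intro l
    induction l with
    | zero => rfl
    | succ l ih => rw [pow_succ', Module.End.mul_apply, ih]; rfl
  intro h
  have h3 := congrArg (fun x => (shiftData q).lift x (fun _ => 1) 0) h
  simp only [map_mul, map_pow, h1, lift_gen, MatData.toFun, one_pow, one_mul, h2, map_zero] at h3
  exact one_ne_zero h3

end GLqPlus

/-! ### Highest weight theory -/

namespace UData

variable {q : 𝕜ˣ} {M : Type*} [AddCommGroup M] [Module 𝕜 M] (d : UData q (Module.End 𝕜 M))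

/-- The divided powers of `F`. -/
def fdiv : ℕ → Module.End 𝕜 M
  | 0 => 1
  | n + 1 => (qInt q (n + 1 : ℕ))⁻¹ • (d.F * fdiv n)

/-- `w` is a highest weight vector of the representation `V_{l,k}`. -/
structure IsHighest (l : ℕ) (k : 𝕜) (w : M) : Prop where
  E : d.E w = 0
  K : d.K w = ((q ^ (l : ℤ) : 𝕜ˣ) : 𝕜) • w
  I : d.I w = k • w
  F : d.fdiv (l + 1) w = 0

variable {d}

theorem fdiv_commute {T : Module.End 𝕜 M} (h : Commute d.F T) (n : ℕ) : Commute (d.fdiv n) T := by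
  induction n with
  | zero => exact Commute.one_left T
  | succ n ih => exact (h.mul_left ih).smul_left _

theorem F_fdiv (hq : ∀ n : ℕ, 0 < n → q ^ n ≠ 1) (n : ℕ) (w : M) :
    d.F (d.fdiv n w) = qInt q (n + 1 : ℕ) • d.fdiv (n + 1) w := by
  rw [fdiv, LinearMap.smul_apply, smul_smul, mul_inv_cancel₀ (qInt_ne_zero hq (by omega)),
    one_smul, Module.End.mul_apply]

namespace IsHighest

variable {l : ℕ} {k : 𝕜} {w : M}

/-- Used with T built from the other of the two commuting actions, so that one ladder can be climbed
after the other. -/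
theorem map (h : d.IsHighest l k w) {T : Module.End 𝕜 M} (hE : Commute d.E T) (hF : Commute d.F T)
    (hK : Commute d.K T) (hI : Commute d.I T) : d.IsHighest l k (T w) where
  E := by rw [← Module.End.mul_apply, hE.eq, Module.End.mul_apply, h.E, map_zero]
  K := by rw [← Module.End.mul_apply, hK.eq, Module.End.mul_apply, h.K, map_smul]
  I := by rw [← Module.End.mul_apply, hI.eq, Module.End.mul_apply, h.I, map_smul]
  F := by
    rw [← Module.End.mul_apply, (fdiv_commute hF _).eq, Module.End.mul_apply, h.F, map_zero]

theorem K_fdiv (h : d.IsHighest l k w) (n : ℕ) :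
    d.K (d.fdiv n w) = ((q ^ ((l : ℤ) - 2 * n) : 𝕜ˣ) : 𝕜) • d.fdiv n w := by
  induction n with
  | zero => simpa [fdiv] using h.K
  | succ n ih =>
    have hKF := LinearMap.congr_fun d.K_F (d.fdiv n w)
    simp only [Module.End.mul_apply, LinearMap.smul_apply, ih, map_smul, smul_smul,
      ← Units.val_mul] at hKF
    rw [fdiv, LinearMap.smul_apply, Module.End.mul_apply, map_smul, hKF, smul_comm]
    congr 3
    rw [show (l : ℤ) - 2 * (n + 1 : ℕ) = -2 + (l - 2 * n) by push_cast; ring, zpow_add]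
    rfl

theorem Kinv_fdiv (h : d.IsHighest l k w) (n : ℕ) :
    d.Kinv (d.fdiv n w) = ((q⁻¹ ^ ((l : ℤ) - 2 * n) : 𝕜ˣ) : 𝕜) • d.fdiv n w := by
  have h1 := LinearMap.congr_fun d.Kinv_K (d.fdiv n w)
  rw [Module.End.mul_apply, h.K_fdiv, map_smul, Module.End.one_apply] at h1
  conv_rhs => rw [← h1, smul_smul, ← Units.val_mul, inv_zpow, inv_mul_cancel]
  rw [Units.val_one, one_smul]

theorem I_fdiv (h : d.IsHighest l k w) (n : ℕ) : d.I (d.fdiv n w) = k • d.fdiv n w := by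
  rw [← Module.End.mul_apply, ← (fdiv_commute (T := d.I) d.I_F.symm n).eq, Module.End.mul_apply,
    h.I, map_smul]

/-- The usual sl(2) computation: on the weight vector F^(n) w the commutator [E, F] acts by [l -
2n], and the contributions add up along the ladder. -/
theorem E_fdiv (hq : ∀ n : ℕ, 0 < n → q ^ n ≠ 1) (h : d.IsHighest l k w) (n : ℕ) :
    d.E (d.fdiv (n + 1) w) = qInt q ((l : ℤ) - n) • d.fdiv n w := by
  have hs := sub_inv_ne_zero hq
  have hEF : ∀ n : ℕ, d.E (d.F (d.fdiv n w)) = d.F (d.E (d.fdiv n w)) +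
      qInt q ((l : ℤ) - 2 * n) • d.fdiv n w := by
    intro n
    have h1 := LinearMap.congr_fun d.E_F (d.fdiv n w)
    simp only [LinearMap.smul_apply, LinearMap.sub_apply, Module.End.mul_apply, h.K_fdiv,
      h.Kinv_fdiv, ← sub_smul] at h1
    rw [← sub_eq_iff_eq_add', qInt, div_eq_inv_mul, mul_smul, ← inv_zpow', ← h1, smul_smul,
      inv_mul_cancel₀ hs, one_smul]
  induction n with
  | zero =>
    rw [show d.fdiv (0 + 1) w = (qInt q (0 + 1 : ℕ))⁻¹ • d.F (d.fdiv 0 w) from rfl, map_smul, hEF]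
    have h1 : qInt q 1 = 1 := by simpa [qInt] using div_self hs
    simp [fdiv, h.E, h1]
  | succ n ih =>
    have hn : qInt q (n + 1 + 1 : ℕ) ≠ 0 := qInt_ne_zero hq (by omega)
    rw [fdiv, LinearMap.smul_apply, Module.End.mul_apply, map_smul, hEF, ih, map_smul, F_fdiv hq,
      smul_smul, ← add_smul, smul_smul]
    congr 1
    rw [inv_mul_eq_iff_eq_mul₀ hn]
    -- This is [n+2][l-n-1] - [n+1][l-n] = [l-2n-2], multiplied by q - q⁻¹.
    have h2 := Vrep.qInt_identity (q := q) ((n + 1 : ℕ) : ℤ) ((l : ℤ) - (n + 1 : ℕ))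
    refine mul_left_cancel₀ hs ?_
    have h3 : ((q : 𝕜) - ((q⁻¹ : 𝕜ˣ) : 𝕜)) * qInt q ((l : ℤ) - 2 * (n + 1 : ℕ)) =
        ((q ^ ((l : ℤ) - 2 * (n + 1 : ℕ)) : 𝕜ˣ) : 𝕜) -
          ((q⁻¹ ^ ((l : ℤ) - 2 * (n + 1 : ℕ)) : 𝕜ˣ) : 𝕜) := by
      rw [qInt, mul_div_cancel₀ _ hs, inv_zpow']
    rw [show (l : ℤ) - (n + 1 : ℕ) - (n + 1 : ℕ) = l - 2 * (n + 1 : ℕ) by ring, ← h3] at h2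
    rw [show (l : ℤ) - n = l - (n + 1 : ℕ) + 1 by push_cast; ring,
      show ((n + 1 + 1 : ℕ) : ℤ) = (n + 1 : ℕ) + 1 by push_cast; ring]
    linear_combination -h2

/-- E leads back down the ladder with the factor [l - n], which is nonzero for n < l. -/
theorem fdiv_ne_zero (hq : ∀ n : ℕ, 0 < n → q ^ n ≠ 1) (h : d.IsHighest l k w) (hw : w ≠ 0)
    {n : ℕ} (hn : n ≤ l) : d.fdiv n w ≠ 0 := by
  induction n with
  | zero => simpa [fdiv] using hw
  | succ n ih =>
    intro h0
    have h1 := h.E_fdiv hq n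
    rw [h0, map_zero, eq_comm, smul_eq_zero] at h1
    exact h1.elim (qInt_ne_zero hq (by omega)) (ih (by omega))

end IsHighest

end UData

-- The standard basis of V and homomorphisms defined by highest weight vectors

namespace Vrep

variable (q : 𝕜ˣ) (l : ℕ) (k : ℤ)

/-- The basis vector `v_n`, or zero if `n > l`. -/
def e (n : ℕ) : Vrep q l k := fun i => if i.1 = n then 1 else 0

theorem e_apply (n : ℕ) (i : Fin (l + 1)) : e q l k n i = if i.1 = n then 1 else 0 := rfl

theorem e_eq_zero {n : ℕ} (h : l < n) : e q l k n = 0 :=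
  ext fun i => if_neg (by omega)

/-- The basis `v₀, …, v_l`. -/
def basis : Module.Basis (Fin (l + 1)) 𝕜 (Vrep q l k) := Pi.basisFun 𝕜 (Fin (l + 1))

theorem basis_apply (i : Fin (l + 1)) : basis q l k i = e q l k i := by
  refine ext fun j => ?_
  rw [e_apply]
  refine (congrFun (Pi.basisFun_apply 𝕜 (Fin (l + 1)) i) j).trans ?_
  simp [Pi.single_apply, Fin.ext_iff]

variable {q l k} in
theorem hom_ext {M : Type*} [AddCommGroup M] [Module 𝕜 M] {f g : Vrep q l k →ₗ[𝕜] M}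
    (h : ∀ n ≤ l, f (e q l k n) = g (e q l k n)) : f = g :=
  (basis q l k).ext fun i => by rw [basis_apply]; exact h _ (by omega)

theorem opE_e_zero : opE q l k (e q l k 0) = 0 :=
  ext fun i => by simp [opE_apply, e_apply]; rfl

theorem opE_e_succ {n : ℕ} (hn : n ≤ l) :
    opE q l k (e q l k (n + 1)) = qInt q ((l : ℤ) - n) • e q l k n := by
  refine ext fun i => ?_
  rw [opE_apply, smul_apply, e_apply]
  by_cases h : i.1 = n
  · by_cases h' : i.1 + 1 < l + 1
    · simp [e_apply, h]
      intro; omega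
    · have : (l : ℤ) - n = 0 := by omega
      simp [h', this, qInt]
  · simp [e_apply, h]

theorem opF_e (n : ℕ) : opF q l k (e q l k n) = qInt q (n + 1 : ℕ) • e q l k (n + 1) := by
  refine ext fun i => ?_
  rw [opF_apply, smul_apply, e_apply]
  by_cases h : i.1 = n + 1
  · simp [e_apply, h]
  · simp only [e_apply, h, if_false, mul_zero]
    split_ifs
    · omega
    · simp
    · rfl

theorem opK_e (u : 𝕜ˣ) (n : ℕ) :
    opK q l k u (e q l k n) = ((u ^ ((l : ℤ) - 2 * n) : 𝕜ˣ) : 𝕜) • e q l k n := by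
  refine ext fun i => ?_
  rw [opK_apply, smul_apply, e_apply]
  split_ifs with h
  · rw [h]
  · simp

variable {q l k} {M : Type*} [AddCommGroup M] [Module 𝕜 M]

/-- The linear map that sends `v_i` to the `i`-th divided power of `F`. -/
def ladder (d : UData q (Module.End 𝕜 M)) : Vrep q l k →ₗ[𝕜] Module.End 𝕜 M :=
  (basis q l k).constr 𝕜 fun i => d.fdiv i

theorem ladder_e (d : UData q (Module.End 𝕜 M)) {n : ℕ} (hn : n ≤ l) :
    ladder d (e q l k n) = d.fdiv n := by
  have h := (basis q l k).constr_basis 𝕜 (fun i => d.fdiv i) ⟨n, by omega⟩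
  rwa [basis_apply] at h

theorem ladder_commute {d : UData q (Module.End 𝕜 M)} {T : Module.End 𝕜 M} (h : Commute d.F T)
    (v : Vrep q l k) : Commute (ladder d v) T := by
  rw [← (basis q l k).sum_repr v, map_sum]
  refine Commute.sum_left _ _ _ fun i _ => ?_
  rw [map_smul, basis_apply, ladder_e d (by omega)]
  exact (UData.fdiv_commute h _).smul_left _

/-- A highest weight vector defines a homomorphism from `V_{l,k}`. -/
theorem ladder_gen (hq : ∀ n : ℕ, 0 < n → q ^ n ≠ 1) {d : UData q (Module.End 𝕜 M)} {w : M}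
    (h : d.IsHighest l k w) (g : UGen) (v : Vrep q l k) :
    ladder d ((data q l k).toFun g v) w = d.toFun g (ladder d v w) := by
  suffices (LinearMap.applyₗ w) ∘ₗ (ladder d) ∘ₗ ((data q l k).toFun g) =
      d.toFun g ∘ₗ (LinearMap.applyₗ w) ∘ₗ (ladder d) from LinearMap.congr_fun this v
  refine hom_ext fun n hn => ?_
  simp only [LinearMap.comp_apply, LinearMap.applyₗ_apply_apply, ladder_e d hn]
  cases g
  · change ladder d (opE q l k (e q l k n)) w = d.E _
    rcases n with _ | n
    · rw [opE_e_zero, map_zero, UData.fdiv, Module.End.one_apply, h.E, LinearMap.zero_apply]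
    · rw [opE_e_succ q l k (by omega), map_smul, ladder_e d (by omega), h.E_fdiv hq]; rfl
  · change ladder d (opF q l k (e q l k n)) w = d.F _
    rw [opF_e, map_smul, UData.F_fdiv hq, LinearMap.smul_apply]
    -- At the last vector, n = l, the left side vanishes because v_{l+1} = 0, and the right side
    -- because a highest weight vector is killed by the divided power of order l + 1.
    rcases hn.lt_or_eq with hn | rfl
    · rw [ladder_e d (by omega)]
    · rw [e_eq_zero _ _ _ (by omega), map_zero, h.F, LinearMap.zero_apply]
  · change ladder d (opK q l k q (e q l k n)) w = d.K _
    rw [opK_e, map_smul, ladder_e d hn, h.K_fdiv]; rfl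
  · change ladder d (opK q l k q⁻¹ (e q l k n)) w = d.Kinv _
    rw [opK_e, map_smul, ladder_e d hn, h.Kinv_fdiv]; rfl
  · change ladder d ((k : 𝕜) • e q l k n) w = d.I _
    rw [map_smul, ladder_e d hn, h.I_fdiv]; rfl

theorem ladder_lift (hq : ∀ n : ℕ, 0 < n → q ^ n ≠ 1) {d : UData q (Module.End 𝕜 M)} {w : M}
    (h : d.IsHighest l k w) (a : Uq q) (v : Vrep q l k) :
    ladder d ((data q l k).lift a v) w = d.lift a (ladder d v w) := by
  have ha : a ∈ Algebra.adjoin 𝕜 (Set.range (Uq.gen q)) := by rw [Uq.adjoin_gen]; trivial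
  induction ha using Algebra.adjoin_induction generalizing v with
  | mem a ha =>
    obtain ⟨g, rfl⟩ := ha
    rw [UData.lift_gen, UData.lift_gen, ladder_gen hq h]
  | algebraMap c => simp [Algebra.algebraMap_eq_smul_one]
  | add x y _ _ h1 h2 => simp only [map_add, LinearMap.add_apply, h1, h2]
  | mul x y _ _ h1 h2 => simp only [map_mul, Module.End.mul_apply, h1, h2]

end Vrep

/-! ### The elements `Y` -/

section Laurent

open LaurentPolynomial

variable {R : Type*} [Ring R]

/-- The recursion of `row` in terms of Laurent polynomials, before the powers of q that come from δ
are extracted. -/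
theorem coeff_linear_mul (x y : R) (f : R[T;T⁻¹]) (m : ℤ) :
    ((C x * T 1 + C y) * f).coeff m = x * f.coeff (m - 1) + y * f.coeff m := by
  rw [add_mul, ← single_eq_C_mul_T, ← single_eq_C, AddMonoidAlgebra.coeff_add, Finsupp.add_apply,
    AddMonoidAlgebra.coeff_single_mul_apply, AddMonoidAlgebra.coeff_single_mul_apply]
  congr 3
  · ring
  · simp

theorem coeff_mul_T (f : R[T;T⁻¹]) (n m : ℤ) : (f * T n).coeff m = f.coeff (m - n) := by
  rw [T, AddMonoidAlgebra.coeff_mul_single_apply, mul_one, sub_eq_add_neg]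

end Laurent

namespace GLqExt

variable (q h : 𝕜ˣ)

theorem gen_eq_incl (g : MatGen) : gen q g.toExt = incl q (GLqPlus.gen q g) := (incl_gen q g).symm

theorem del_mul_gen {g : MatGen} {c : 𝕜} {x y : FreeAlgebra 𝕜 ExtGen}
    (hr : ExtRel q x y) (hx : x = FreeAlgebra.ι 𝕜 ExtGen.del * FreeAlgebra.ι 𝕜 g.toExt)
    (hy : y = c • (FreeAlgebra.ι 𝕜 g.toExt * FreeAlgebra.ι 𝕜 ExtGen.del)) :
    (del q : GLqExt q) * incl q (GLqPlus.gen q g) =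
      c • (incl q (GLqPlus.gen q g) * del q) := by
  have h := RingQuot.mkAlgHom_rel 𝕜 hr
  rw [hx, hy, map_smul, map_mul, map_mul] at h
  rw [incl_gen]
  exact h

/-- Conjugation by δ is the torus automorphism with u = w = h, so every δ can be collected on the
left. -/
theorem incl_mul_del (hh : h ^ 2 = q) (x : GLqPlus q) :
    incl q x * del q = del q * incl q (GLqPlus.torus q h⁻¹ h⁻¹ x) := by
  have hh' : (h : 𝕜) * h = q := by rw [← hh]; push_cast; ring
  have hh'' : (h : 𝕜)⁻¹ * (h : 𝕜)⁻¹ = (q : 𝕜)⁻¹ := by rw [← hh', mul_inv]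
  induction x using GLqPlus.induction with
  | hg g =>
    rw [GLqPlus.torus_gen, map_smul, mul_smul_comm]
    cases g
    · rw [del_mul_gen q (c := 1) ExtRel.del_A rfl (one_smul _ _).symm]
      simp [GLqPlus.weight]
    · rw [del_mul_gen q ExtRel.del_B rfl rfl]
      simp [GLqPlus.weight, smul_smul, hh'']
    · rw [del_mul_gen q ExtRel.del_C rfl rfl]
      simp [GLqPlus.weight, smul_smul, hh']
    · rw [del_mul_gen q (c := 1) ExtRel.del_D rfl (one_smul _ _).symm]
      simp [GLqPlus.weight]
  | hc c => rw [AlgHom.commutes, AlgHom.commutes, AlgHom.commutes, Algebra.commutes]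
  | ha x y h1 h2 => simp only [map_add, add_mul, mul_add, h1, h2]
  | hm x y h1 h2 => rw [map_mul, mul_assoc, h2, ← mul_assoc, h1, mul_assoc, ← map_mul, ← map_mul]

theorem incl_gen_mul_del_pow (hh : h ^ 2 = q) (g : MatGen) (n : ℕ) :
    incl q (GLqPlus.gen q g) * (del q : GLqExt q) ^ n =
      (GLqPlus.weight h⁻¹ h⁻¹ g : 𝕜) ^ n • ((del q : GLqExt q) ^ n * incl q (GLqPlus.gen q g)) :=
  GLqPlus.mul_pow_of_skew
    (by rw [incl_mul_del q h hh, GLqPlus.torus_gen, map_smul, mul_smul_comm]) n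

/-- The square roots in x₁₂ and x₂₁ cancel. Moving the second δ to the left past A costs nothing,
and past B it costs q⁻¹, the coefficient in `qdet`. -/
theorem detx_eq (hh : h ^ 2 = q) :
    detx q h = (del q : GLqExt q) ^ 2 * incl q (GLqPlus.qdet q) := by
  have hh'' : (h : 𝕜)⁻¹ * (h : 𝕜)⁻¹ = (q : 𝕜)⁻¹ := by
    rw [← hh, ← mul_inv]; push_cast; rw [pow_two]
  have hA := incl_gen_mul_del_pow q h hh .A 1
  have hB := incl_gen_mul_del_pow q h hh .B 1
  simp only [pow_one] at hA hB
  rw [detx, x11, x22, x12, x21, show ExtGen.A = MatGen.A.toExt from rfl,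
    show ExtGen.B = MatGen.B.toExt from rfl, show ExtGen.C = MatGen.C.toExt from rfl,
    show ExtGen.D = MatGen.D.toExt from rfl]
  simp only [gen_eq_incl]
  rw [smul_mul_smul_comm, ← Units.val_mul, inv_mul_cancel, Units.val_one, one_smul, mul_assoc,
    ← mul_assoc (incl q (GLqPlus.gen q .A)), hA, mul_assoc (del q : GLqExt q),
    ← mul_assoc (incl q (GLqPlus.gen q .B)), hB, GLqPlus.qdet]
  simp [GLqPlus.weight, hh'', mul_sub, pow_two, mul_assoc]

theorem detx_pow (hh : h ^ 2 = q) (j : ℕ) :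
    detx q h ^ j = (del q : GLqExt q) ^ (2 * j) * incl q (GLqPlus.qdet q ^ j) := by
  have hc : Commute (del q : GLqExt q) (incl q (GLqPlus.qdet q)) := by
    have := incl_mul_del q h hh (GLqPlus.qdet q)
    rw [GLqPlus.torus_qdet] at this
    exact this.symm
  rw [detx_eq q h hh, (hc.pow_left 2).mul_pow, pow_mul, map_pow]

-- Moving δⁿ to the left past B costs q⁻ⁿ and past D nothing, so a new factor becomes q⁻ⁿ times the
-- row B s + qⁿ D. Each power of s comes with one h⁻¹ from x₁₂. The unit t must not depend on m,
-- since the recursion mixes neighbouring coefficients.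
open LaurentPolynomial in
theorem exists_coeff_rowProd (hh : h ^ 2 = q) (n : ℕ) : ∃ t : 𝕜ˣ, ∀ m : ℤ,
    ((C (x12 q h) * T 1 + C (x22 q)) ^ n).coeff m = ((h ^ (-m) * t : 𝕜ˣ) : 𝕜) •
      ((del q : GLqExt q) ^ n * incl q (GLqPlus.rowProd q n m)) := by
  induction n with
  | zero =>
    refine ⟨1, fun m => ?_⟩
    rw [pow_zero, pow_zero, ← T_zero, T_apply, GLqPlus.rowProd]
    by_cases hm : m = 0
    · subst hm; simp
    · simp [hm, Ne.symm hm]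
  | succ n ih =>
    obtain ⟨t, ht⟩ := ih
    refine ⟨t * (q ^ n)⁻¹, fun m => ?_⟩
    have hB := incl_gen_mul_del_pow q h hh .B n
    have hD := incl_gen_mul_del_pow q h hh .D n
    -- `e1` matches the scalars of the B-term; `e2` below restores the factor qⁿ that the D-term has
    -- in `row`.
    have e1 : h⁻¹ * (h ^ (-(m - 1)) * t) * (h⁻¹ * h⁻¹) ^ n = h ^ (-m) * (t * (q ^ n)⁻¹) := by
      rw [show -(m - 1) = 1 + -m by ring, zpow_add, zpow_one, ← mul_inv, ← pow_two, hh, inv_pow]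
      simp [mul_assoc]
    rw [pow_succ' (C _ * T 1 + C _), coeff_linear_mul, ht, ht, x12, x22,
      show ExtGen.B = MatGen.B.toExt from rfl, show ExtGen.D = MatGen.D.toExt from rfl]
    simp only [gen_eq_incl]
    rw [smul_mul_smul_comm, mul_smul_comm, mul_assoc, ← mul_assoc (incl q _), hB, mul_assoc,
      ← mul_assoc (incl q (GLqPlus.gen q .D)), hD, GLqPlus.rowProd, GLqPlus.row, map_add, map_smul,
      map_mul, map_mul, mul_add, smul_add, ← e1]
    have e2 : (h⁻¹ * (h ^ (-(m - 1)) * t) * (h⁻¹ * h⁻¹) ^ n) * q ^ n = h ^ (-m) * t := by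
      rw [e1]; simp [mul_assoc]
    congr 1
    · simp only [smul_mul_assoc, mul_smul_comm, smul_smul, pow_succ', mul_assoc, GLqPlus.weight]
      push_cast
      simp only [mul_assoc]
    · rw [mul_smul_comm, smul_smul, ← Units.val_pow_eq_pow_val q, ← Units.val_mul, e2]
      simp [pow_succ', mul_assoc, GLqPlus.weight]

-- A commutes with δ, while moving δ^(b+a) to the left past C produces the factor q^(b+a) of the
-- row. The extra h comes from x₂₁; in the A-term the lower power of s supplies the same h.
open LaurentPolynomial in
theorem exists_coeff_chain (hh : h ^ 2 = q) (b a : ℕ) : ∃ t : 𝕜ˣ, ∀ m : ℤ,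
    ((C (x11 q) * T 1 + C (x21 q h)) ^ a * (C (x12 q h) * T 1 + C (x22 q)) ^ b).coeff m =
      ((h ^ (a - m) * t : 𝕜ˣ) : 𝕜) •
        ((del q : GLqExt q) ^ (b + a) * incl q (GLqPlus.chain q b a m)) := by
  obtain ⟨t, ht⟩ := exists_coeff_rowProd q h hh b
  refine ⟨t, ?_⟩
  induction a with
  | zero =>
    intro m
    rw [pow_zero, one_mul, ht]
    simp [GLqPlus.chain]
  | succ a ih =>
    intro m
    have hA := incl_gen_mul_del_pow q h hh .A (b + a)
    have hC := incl_gen_mul_del_pow q h hh .C (b + a)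
    have e1 : h ^ (a - (m - 1)) * t = h ^ ((a + 1 : ℕ) - m) * t := by
      congr 2; push_cast; ring
    have e2 : h * (h ^ (a - m) * t) * (h * h) ^ (b + a) =
        h ^ ((a + 1 : ℕ) - m) * t * q ^ (b + a) := by
      rw [← pow_two, hh, show ((a + 1 : ℕ) : ℤ) - m = 1 + (a - m) by push_cast; ring, zpow_add,
        zpow_one]
      simp only [mul_assoc]
    rw [pow_succ', mul_assoc (C _ * T 1 + C _), coeff_linear_mul, ih, ih, x11, x21,
      show ExtGen.A = MatGen.A.toExt from rfl, show ExtGen.C = MatGen.C.toExt from rfl]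
    simp only [gen_eq_incl]
    rw [smul_mul_smul_comm, mul_smul_comm, mul_assoc, ← mul_assoc (incl q _), hA, mul_assoc,
      ← mul_assoc (incl q (GLqPlus.gen q .C)), hC, GLqPlus.chain, GLqPlus.row, map_add, map_smul,
      map_mul, map_mul, mul_add, smul_add, e1]
    congr 1
    · simp [pow_succ', mul_assoc, GLqPlus.weight, ← add_assoc]
    · rw [mul_smul_comm, smul_smul, ← Units.val_pow_eq_pow_val q,
        ← Units.val_mul (h ^ (((a + 1 : ℕ) : ℤ) - m) * t), ← e2]
      simp only [smul_mul_assoc, mul_smul_comm, smul_smul, pow_succ', mul_assoc, GLqPlus.weight,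
        ← add_assoc, inv_inv]
      push_cast
      simp only [mul_assoc]

/-- The power of δ is -2j - l from the definition, 2j from the determinant and l = b + a from the
product of rows, hence zero in total. So Y comes from GL_q^+(2). -/
theorem exists_Y_eq (hh : h ^ 2 = q) {l : ℕ} (j : ℕ) {r k : ℤ} {b a : ℕ} {m : ℤ} (hl : l = b + a)
    (hr : r = b - a) (hk : k = l - 2 * m) : ∃ t : 𝕜ˣ,
    Y q h l j r k = (t : 𝕜) • incl q (GLqPlus.qdet q ^ j * GLqPlus.chain q b a m) := by
  obtain ⟨t, ht⟩ := exists_coeff_chain q h hh b a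
  refine ⟨h ^ (a - m) * t, ?_⟩
  have h1 : (((l : ℤ) - r) / 2).toNat = a := by omega
  have h2 : (((l : ℤ) + r) / 2).toNat = b := by omega
  -- The residue picks out the coefficient of s^m with m = (l - k)/2.
  have h3 : -1 - ((k - l) / 2 - 1) = m := by omega
  have hX : X q h l r k = ((h ^ (a - m) * t : 𝕜ˣ) : 𝕜) •
      ((del q : GLqExt q) ^ (b + a) * incl q (GLqPlus.chain q b a m)) := by
    rw [X, h1, h2, coeff_mul_T, h3, ht]
  have hc : Commute (incl q (GLqPlus.qdet q ^ j)) ((del q : GLqExt q) ^ (b + a)) := by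
    refine Commute.pow_right ?_ _
    have := incl_mul_del q h hh (GLqPlus.qdet q ^ j)
    rwa [map_pow (GLqPlus.torus q _ _), GLqPlus.torus_qdet] at this
  rw [Y, hX, detx_pow q h hh, mul_smul_comm, map_mul]
  congr 1
  rw [← mul_assoc, mul_assoc _ _ ((del q : GLqExt q) ^ (b + a)), mul_assoc ((del q : GLqExt q) ^ _),
    hc.eq]
  simp only [← mul_assoc]
  rw [← Units.val_pow_eq_pow_val, ← Units.val_pow_eq_pow_val, ← Units.val_mul, ← Units.val_mul,
    ← zpow_natCast, ← zpow_natCast, ← zpow_add, ← zpow_add, hl]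
  rw [show -2 * (j : ℤ) - (b + a : ℕ) + (2 * j : ℕ) + (b + a : ℕ) = 0 by push_cast; ring]
  simp

end GLqExt

open GLqPlus

/-! ### Homomorphisms from `V_{l,k} ⊗ V̄_{l,k}` -/

theorem GLqPlus.tmul_smul {q : 𝕜ˣ} (a : Uq q) (b : Uq q⁻¹) (x : GLqPlus q) :
    (a ⊗ₜ[𝕜] b) • x = (leftData q).lift a ((rightData q).lift b x) := by
  rw [GLqPlus.smul_def, GLqPlus.action, Algebra.TensorProduct.lift_tmul, Module.End.mul_apply]

namespace VVbar

variable {q : 𝕜ˣ} {l : ℕ} {k : ℤ}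

/-- Pure tensors. -/
def tmul (v : Vrep q l k) (v' : Vrep q⁻¹ l k) : VVbar q l k := v ⊗ₜ[𝕜] v'

theorem tmul_smul (a : Uq q) (b : Uq q⁻¹) (v : Vrep q l k) (v' : Vrep q⁻¹ l k) :
    (a ⊗ₜ[𝕜] b) • tmul v v' =
      tmul ((Vrep.data q l k).lift a v) ((Vrep.data q⁻¹ l k).lift b v') := by
  change VVbar.action q l k (a ⊗ₜ[𝕜] b) (v ⊗ₜ[𝕜] v') = _
  rw [VVbar.action, AlgHom.comp_apply, Algebra.TensorProduct.map_tmul,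
    Module.endTensorEndAlgHom_apply]
  rfl

instance : IsScalarTower 𝕜 (Uq q ⊗[𝕜] Uq q⁻¹) (VVbar q l k) where
  smul_assoc c a x := by
    exact LinearMap.congr_fun (map_smul (VVbar.action q l k) c a) x

theorem smul_tmul (c : 𝕜) (v : Vrep q l k) (v' : Vrep q⁻¹ l k) :
    tmul (c • v) v' = c • tmul v v' := rfl

theorem tmul_smul_right (c : 𝕜) (v : Vrep q l k) (v' : Vrep q⁻¹ l k) :
    tmul v (c • v') = c • tmul v v' := TensorProduct.tmul_smul c v v'

theorem zero_tmul (v' : Vrep q⁻¹ l k) : tmul (0 : Vrep q l k) v' = 0 :=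
  TensorProduct.zero_tmul _ _

@[elab_as_elim]
theorem induction_on {P : VVbar q l k → Prop} (x : VVbar q l k) (zero : P 0)
    (tmul : ∀ v v', P (tmul v v')) (add : ∀ x y, P x → P y → P (x + y)) : P x :=
  TensorProduct.induction_on x zero tmul add

variable (q l k) in
/-- The basis `v_a ⊗ v̄_i`. -/
def basis : Module.Basis (Fin (l + 1) × Fin (l + 1)) 𝕜 (VVbar q l k) :=
  (Vrep.basis q l k).tensorProduct (Vrep.basis q⁻¹ l k)

theorem basis_apply (p : Fin (l + 1) × Fin (l + 1)) :
    basis q l k p = tmul (Vrep.e q l k p.1) (Vrep.e q⁻¹ l k p.2) := by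
  rw [← Vrep.basis_apply, ← Vrep.basis_apply]
  exact Module.Basis.tensorProduct_apply' _ _ _

theorem leftData_smul (f : VVbar q l k →ₗ[Uq q ⊗[𝕜] Uq q⁻¹] GLqPlus q) (g : UGen)
    (v : Vrep q l k) (v' : Vrep q⁻¹ l k) :
    (leftData q).toFun g (f (tmul v v')) = f (tmul ((Vrep.data q l k).toFun g v) v') := by
  have h := f.map_smul (Uq.gen q g ⊗ₜ[𝕜] 1) (tmul v v')
  rw [tmul_smul, GLqPlus.tmul_smul, UData.lift_gen, UData.lift_gen, map_one, map_one] at h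
  exact h.symm

theorem rightData_smul (f : VVbar q l k →ₗ[Uq q ⊗[𝕜] Uq q⁻¹] GLqPlus q) (g : UGen)
    (v : Vrep q l k) (v' : Vrep q⁻¹ l k) :
    (rightData q).toFun g (f (tmul v v')) = f (tmul v ((Vrep.data q⁻¹ l k).toFun g v')) := by
  have h := f.map_smul ((1 : Uq q) ⊗ₜ[𝕜] Uq.gen q⁻¹ g) (tmul v v')
  rw [tmul_smul, GLqPlus.tmul_smul, UData.lift_gen, UData.lift_gen, map_one, map_one] at h
  exact h.symm

theorem inv_not_root (hq : ∀ n : ℕ, 0 < n → q ^ n ≠ 1) : ∀ n : ℕ, 0 < n → q⁻¹ ^ n ≠ 1 :=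
  fun n hn h => hq n hn (by rwa [inv_pow, inv_eq_one] at h)

/-- A homomorphism is determined by the image of the highest weight vector. -/
theorem hom_e_e (hq : ∀ n : ℕ, 0 < n → q ^ n ≠ 1)
    (f : VVbar q l k →ₗ[Uq q ⊗[𝕜] Uq q⁻¹] GLqPlus q) (n m : ℕ) :
    f (tmul (Vrep.e q l k n) (Vrep.e q⁻¹ l k m)) = (leftData q).fdiv n ((rightData q).fdiv m
      (f (tmul (Vrep.e q l k 0) (Vrep.e q⁻¹ l k 0)))) := by
  have hl : ∀ v', f (tmul (Vrep.e q l k n) v') =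
      (leftData q).fdiv n (f (tmul (Vrep.e q l k 0) v')) := by
    intro v'
    induction n with
    | zero => rfl
    | succ n ih =>
      have h := leftData_smul f .F (Vrep.e q l k n) v'
      have h1 : (Vrep.data q l k).toFun .F (Vrep.e q l k n) = _ := Vrep.opF_e q l k n
      rw [h1, smul_tmul, LinearMap.map_smul_of_tower, ih] at h
      rw [UData.fdiv, LinearMap.smul_apply, Module.End.mul_apply,
        show (leftData q).F = (leftData q).toFun .F from rfl, h, smul_smul,
        inv_mul_cancel₀ (qInt_ne_zero hq (by omega)), one_smul]
  have hr : ∀ v, f (tmul v (Vrep.e q⁻¹ l k m)) =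
      (rightData q).fdiv m (f (tmul v (Vrep.e q⁻¹ l k 0))) := by
    intro v
    induction m with
    | zero => rfl
    | succ m ih =>
      have h := rightData_smul f .F v (Vrep.e q⁻¹ l k m)
      have h1 : (Vrep.data q⁻¹ l k).toFun .F (Vrep.e q⁻¹ l k m) = _ := Vrep.opF_e q⁻¹ l k m
      rw [h1, tmul_smul_right, LinearMap.map_smul_of_tower, ih] at h
      rw [UData.fdiv, LinearMap.smul_apply, Module.End.mul_apply,
        show (rightData q).F = (rightData q).toFun .F from rfl, h, smul_smul,
        inv_mul_cancel₀ (qInt_ne_zero (inv_not_root hq) (by omega)), one_smul]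
  rw [hl, hr]

/-- The linear map `v ⊗ v̄ ↦ ladder v (ladder v̄ w)`. -/
def ladderHom (w : GLqPlus q) : VVbar q l k →ₗ[𝕜] GLqPlus q :=
  (TensorProduct.lift <| LinearMap.mk₂ 𝕜
      (fun v v' => Vrep.ladder (leftData q) v (Vrep.ladder (rightData q) v' w))
      (fun _ _ _ => by rw [map_add, LinearMap.add_apply])
      (fun _ _ _ => by rw [map_smul, LinearMap.smul_apply])
      (fun _ _ _ => by rw [map_add, LinearMap.add_apply, map_add])
      (fun _ _ _ => by rw [map_smul, LinearMap.smul_apply, map_smul]) :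
    Vrep q l k ⊗[𝕜] Vrep q⁻¹ l k →ₗ[𝕜] GLqPlus q)

theorem ladderHom_tmul (w : GLqPlus q) (v : Vrep q l k) (v' : Vrep q⁻¹ l k) :
    ladderHom w (tmul v v') = Vrep.ladder (leftData q) v (Vrep.ladder (rightData q) v' w) :=
  rfl

/-- The homomorphism from `V_{l,k} ⊗ V̄_{l,k}` defined by a highest weight vector. -/
def homOfHighest (hq : ∀ n : ℕ, 0 < n → q ^ n ≠ 1) {w : GLqPlus q}
    (h : (leftData q).IsHighest l (k : 𝕜) w) (h' : (rightData q).IsHighest l (k : 𝕜) w) :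
    VVbar q l k →ₗ[Uq q ⊗[𝕜] Uq q⁻¹] GLqPlus q :=
  { toFun := ladderHom w
    map_add' := map_add _
    map_smul' := fun a x => by
      have hc : ∀ g g', Commute ((leftData q).toFun g) ((rightData q).toFun g') :=
        fun g g' => LinearMap.ext fun x => left_right_gen q g g' x
      have key : ∀ a b (v : Vrep q l k) (v' : Vrep q⁻¹ l k),
          ladderHom w (tmul ((Vrep.data q l k).lift a v) ((Vrep.data q⁻¹ l k).lift b v')) =
            (leftData q).lift a ((rightData q).lift b (ladderHom w (tmul v v'))) := by
        intro a b v v'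
        -- Since the two actions commute, each ladder maps w to a vector that is still of highest
        -- weight for the other action. Linearity over both algebras is then checked for one ladder
        -- at a time, exchanging their order by `h3`.
        have h1 : ∀ v' : Vrep q⁻¹ l k,
            (leftData q).IsHighest l (k : 𝕜) (Vrep.ladder (rightData q) v' w) := fun v' =>
          h.map (Vrep.ladder_commute (hc .E .F).symm v').symm
            (Vrep.ladder_commute (hc .F .F).symm v').symm
            (Vrep.ladder_commute (hc .K .F).symm v').symm
            (Vrep.ladder_commute (hc .I .F).symm v').symm
        have h2 : (rightData q).IsHighest l (k : 𝕜) (Vrep.ladder (leftData q) v w) :=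
          h'.map (Vrep.ladder_commute (hc .F .E) v).symm (Vrep.ladder_commute (hc .F .F) v).symm
            (Vrep.ladder_commute (hc .F .K) v).symm (Vrep.ladder_commute (hc .F .I) v).symm
        have h3 : ∀ v' : Vrep q⁻¹ l k,
            Vrep.ladder (leftData q) v (Vrep.ladder (rightData q) v' w) =
              Vrep.ladder (rightData q) v' (Vrep.ladder (leftData q) v w) := fun v' =>
          LinearMap.congr_fun
            (Vrep.ladder_commute (Vrep.ladder_commute (hc .F .F).symm v').symm v).eq w
        rw [ladderHom_tmul, ladderHom_tmul, Vrep.ladder_lift hq (h1 _), h3, Vrep.ladder_lift (inv_not_root hq) h2, h3]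
      rw [RingHom.id_apply]
      induction a using TensorProduct.induction_on with
      | zero => rw [zero_smul, zero_smul, map_zero]
      | add a b ha hb => rw [add_smul, add_smul, map_add, ha, hb]
      | tmul a b =>
        induction x using VVbar.induction_on with
        | zero => rw [smul_zero, map_zero, smul_zero]
        | add x y hx hy => rw [smul_add, map_add, map_add, smul_add, hx, hy]
        | tmul v v' => rw [tmul_smul, key, GLqPlus.tmul_smul] }

theorem homOfHighest_e_e (hq : ∀ n : ℕ, 0 < n → q ^ n ≠ 1) {w : GLqPlus q}
    (h : (leftData q).IsHighest l (k : 𝕜) w) (h' : (rightData q).IsHighest l (k : 𝕜) w)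
    {n m : ℕ} (hn : n ≤ l) (hm : m ≤ l) :
    homOfHighest hq h h' (tmul (Vrep.e q l k n) (Vrep.e q⁻¹ l k m)) =
      (leftData q).fdiv n ((rightData q).fdiv m w) := by
  rw [← Vrep.ladder_e (l := l) (k := k) (leftData q) hn,
    ← Vrep.ladder_e (l := l) (k := k) (rightData q) hm]
  exact ladderHom_tmul _ _ _

end VVbar

/-! ### The isotypic component -/

section Component

variable {q : 𝕜ˣ} (hq : ∀ n : ℕ, 0 < n → q ^ n ≠ 1) (l j : ℕ)

theorem leftF_qdet_chain (hs : (q : 𝕜) - ((q⁻¹ : 𝕜ˣ) : 𝕜) ≠ 0) (b a : ℕ) (m : ℤ) :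
    (leftData q).F (qdet q ^ j * chain q (b + 1) a m) =
      qInt q (b + 1 : ℕ) • (qdet q ^ j * chain q b (a + 1) m) := by
  change (leftFData q).der _ = _
  rw [leftF_qdet_pow_mul, leftF_chain q hs, mul_smul_comm]

-- F^(n) turns n of the l rows (B, D) into rows (A, C). Only the invertibility of the accumulated
-- scalar is needed.
include hq in
theorem exists_leftFdiv_qdet_chain (m : ℤ) {n : ℕ} (hn : n ≤ l) : ∃ c : 𝕜ˣ,
    (leftData q).fdiv n (qdet q ^ j * chain q l 0 m) =
      (c : 𝕜) • (qdet q ^ j * chain q (l - n) n m) := by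
  induction n with
  | zero => exact ⟨1, by simp [UData.fdiv]⟩
  | succ n ih =>
    obtain ⟨c, hc⟩ := ih (by omega)
    have h1 : qInt q (n + 1 : ℕ) ≠ 0 := qInt_ne_zero hq (by omega)
    have h2 : qInt q (l - (n + 1) + 1 : ℕ) ≠ 0 := qInt_ne_zero hq (by omega)
    refine ⟨(Units.mk0 _ h1)⁻¹ * c * Units.mk0 _ h2, ?_⟩
    rw [UData.fdiv, LinearMap.smul_apply, Module.End.mul_apply, hc, map_smul,
      show l - n = l - (n + 1) + 1 by omega, leftF_qdet_chain j (sub_inv_ne_zero hq), smul_smul,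
      smul_smul]
    simp [mul_assoc]

include hq in
theorem leftFdiv_qdet_chain_eq_zero (m : ℤ) :
    (leftData q).fdiv (l + 1) (qdet q ^ j * chain q l 0 m) = 0 := by
  obtain ⟨c, hc⟩ := exists_leftFdiv_qdet_chain hq l j m le_rfl
  rw [UData.fdiv, LinearMap.smul_apply, Module.End.mul_apply, hc, map_smul, Nat.sub_self]
  change _ • _ • (leftFData q).der _ = _
  rw [leftF_qdet_pow_mul, leftF_chain_zero, mul_zero, smul_zero, smul_zero]

include hq in
theorem one_sub_zpow_ne_zero {n : ℤ} (hn : n ≠ 0) : 1 - (q : 𝕜) ^ n ≠ 0 := by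
  intro h
  have h1 : q ^ (0 : ℤ) = q ^ n := Units.ext (by simpa using sub_eq_zero.1 h)
  exact hn (zpow_inj_of_not_root hq h1).symm

include hq in
theorem rightF_qdet_rowProd (m : ℤ) :
    (rightData q).F (qdet q ^ j * rowProd q l m) =
      ((1 - (q : 𝕜) ^ (-2 : ℤ))⁻¹ * (1 - (q : 𝕜) ^ (2 * (m - 1 - l)))) •
        (qdet q ^ j * rowProd q l (m - 1)) := by
  change (rightFData q).der _ = _
  have h := rightF_rowProd q l m
  rw [show (q : 𝕜)⁻¹ ^ 2 = (q : 𝕜) ^ (-2 : ℤ) by simp] at h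
  rw [rightF_qdet_pow_mul, mul_smul, ← mul_smul_comm, ← h, mul_smul_comm, smul_smul,
    inv_mul_cancel₀ (one_sub_zpow_ne_zero hq (by omega)), one_smul]

-- Starting from the top coefficient, each F̄ lowers the power of s by one. The scalar of step n
-- contains 1 - q^(-2(n+1)), which is nonzero.
include hq in
theorem exists_rightFdiv_qdet_rowProd {n : ℕ} (hn : n ≤ l) : ∃ c : 𝕜ˣ,
    (rightData q).fdiv n (qdet q ^ j * rowProd q l l) =
      (c : 𝕜) • (qdet q ^ j * rowProd q l (l - n)) := by
  induction n with
  | zero => exact ⟨1, by simp [UData.fdiv]⟩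
  | succ n ih =>
    obtain ⟨c, hc⟩ := ih (by omega)
    have h1 : qInt q⁻¹ (n + 1 : ℕ) ≠ 0 := qInt_ne_zero (VVbar.inv_not_root hq) (by omega)
    have h2 := one_sub_zpow_ne_zero hq (show (-2 : ℤ) ≠ 0 by omega)
    have h3 := one_sub_zpow_ne_zero hq (show 2 * ((l : ℤ) - n - 1 - l) ≠ 0 by omega)
    refine ⟨(Units.mk0 _ h1)⁻¹ * c * ((Units.mk0 _ h2)⁻¹ * Units.mk0 _ h3), ?_⟩
    rw [UData.fdiv, LinearMap.smul_apply, Module.End.mul_apply, hc, map_smul,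
      rightF_qdet_rowProd hq, smul_smul, smul_smul,
      show (l : ℤ) - (n + 1 : ℕ) = l - n - 1 by push_cast; ring]
    simp only [Units.val_mul, Units.val_inv_eq_inv_val, Units.val_mk0]

include hq in
theorem rightFdiv_qdet_rowProd_eq_zero :
    (rightData q).fdiv (l + 1) (qdet q ^ j * rowProd q l l) = 0 := by
  obtain ⟨c, hc⟩ := exists_rightFdiv_qdet_rowProd hq l j le_rfl
  rw [UData.fdiv, LinearMap.smul_apply, Module.End.mul_apply, hc, map_smul,
    rightF_qdet_rowProd hq, rowProd_eq_zero_of_neg q l (by omega)]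
  simp

theorem leftE_highest : (leftEData q).der (qdet q ^ j * gen q .B ^ l) = 0 := by
  rw [leftE_qdet_pow_mul, (leftEData q).der_pow_eq_zero ((leftEData q).der_gen .B), mul_zero]

theorem rightE_highest : (rightEData q).der (qdet q ^ j * gen q .B ^ l) = 0 := by
  rw [rightE_qdet_pow_mul, (rightEData q).der_pow_eq_zero ((rightEData q).der_gen .B), mul_zero]

theorem torus_highest (u w : 𝕜ˣ) : torus q u w (qdet q ^ j * gen q .B ^ l) =
    ((u ^ (l : ℤ) * w ^ (l : ℤ) : 𝕜ˣ) : 𝕜) • (qdet q ^ j * gen q .B ^ l) := by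
  rw [torus_qdet_pow_mul, map_pow, torus_gen, smul_pow, mul_smul_comm, ← Units.val_pow_eq_pow_val]
  simp [GLqPlus.weight, mul_pow]

theorem deg_highest : (degData q).der (qdet q ^ j * gen q .B ^ l) =
    ((l + 2 * j : ℕ) : 𝕜) • (qdet q ^ j * gen q .B ^ l) := by
  rw [deg_mul (deg_pow (deg_qdet q) j) (deg_pow (deg_gen q .B) l)]
  congr 1
  push_cast
  ring

include hq in
theorem isHighest_left :
    (leftData q).IsHighest l (((l : ℤ) + 2 * j : ℤ) : 𝕜) (qdet q ^ j * gen q .B ^ l) where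
  E := leftE_highest l j
  K := (torus_highest l j q 1).trans (by simp)
  I := (deg_highest l j).trans (by push_cast; rfl)
  F := by rw [← rowProd_self]; exact leftFdiv_qdet_chain_eq_zero hq l j l

include hq in
theorem isHighest_right :
    (rightData q).IsHighest l (((l : ℤ) + 2 * j : ℤ) : 𝕜) (qdet q ^ j * gen q .B ^ l) where
  E := rightE_highest l j
  K := (torus_highest l j 1 q⁻¹).trans (by simp)
  I := (deg_highest l j).trans (by push_cast; rfl)
  F := by rw [← rowProd_self]; exact rightFdiv_qdet_rowProd_eq_zero hq l j

/-- The embedding of `V_{l,l+2j} ⊗ V̄_{l,l+2j}` into `GL_q^+(2)`. -/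
def embedding : VVbar q l (l + 2 * j) →ₗ[Uq q ⊗[𝕜] Uq q⁻¹] GLqPlus q :=
  VVbar.homOfHighest hq (isHighest_left hq l j) (isHighest_right hq l j)

/-- F̄ is applied first, while only rows (B, D) are present, and selects the power l - i of s; then
F changes a of the rows. -/
theorem exists_embedding_e_e {a i : ℕ} (ha : a ≤ l) (hi : i ≤ l) : ∃ c : 𝕜ˣ,
    embedding hq l j (VVbar.tmul (Vrep.e q l _ a) (Vrep.e q⁻¹ l _ i)) =
      (c : 𝕜) • (qdet q ^ j * chain q (l - a) a (l - i)) := by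
  obtain ⟨c, hc⟩ := exists_rightFdiv_qdet_rowProd hq l j hi
  obtain ⟨c', hc'⟩ := exists_leftFdiv_qdet_chain hq l j (l - i) ha
  refine ⟨c * c', ?_⟩
  rw [embedding, VVbar.homOfHighest_e_e hq _ _ ha hi, ← rowProd_self, hc, map_smul]
  rw [chain] at hc'
  rw [hc', smul_smul, Units.val_mul]

/-- The tensor basis is sent to nonzero eigenvectors of a single operator with pairwise distinct
eigenvalues, so the images are independent. -/
theorem embedding_injective : Function.Injective (embedding hq l j) := by
  suffices Function.Injective ((embedding hq l j).restrictScalars 𝕜) from this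
  refine LinearMap.injective_of_linearIndependent (VVbar.basis q l _).span_eq ?_
  set N : ℕ := l + 1 with hN
  -- Choosing w = q^N with N = l + 1 encodes both weights in one exponent: a and i, both less than
  -- N, are the base-N digits of a + N i.
  refine Module.End.eigenvectors_linearIndependent' (torus q q (q ^ N)).toLinearMap
    (fun p : Fin (l + 1) × Fin (l + 1) =>
      ((q ^ ((l - 2 * p.1.1 : ℤ) + N * (l - 2 * p.2.1)) : 𝕜ˣ) : 𝕜)) ?_ _ fun p => ?_
  · rintro ⟨a, i⟩ ⟨a', i'⟩ h
    have h1 := zpow_inj_of_not_root hq (Units.ext h)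
    have h2 : a.1 + N * i.1 = a'.1 + N * i'.1 := by
      zify
      refine mul_left_cancel₀ (two_ne_zero (α := ℤ)) ?_
      linear_combination -h1
    have h3 : a.1 = a'.1 := by
      have h4 := congrArg (· % N) h2
      simpa [Nat.mod_eq_of_lt, a.2, a'.2, hN] using h4
    have h5 : i.1 = i'.1 := by
      rw [h3] at h2
      exact Nat.eq_of_mul_eq_mul_left (Nat.succ_pos l) (Nat.add_left_cancel h2)
    exact Prod.ext (Fin.ext h3) (Fin.ext h5)
  · have ha : p.1.1 ≤ l := by omega
    have hi : p.2.1 ≤ l := by omega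
    rw [Function.comp_apply, VVbar.basis_apply, LinearMap.restrictScalars_apply,
      Module.End.hasEigenvector_iff, Module.End.mem_eigenspace_iff]
    constructor
    · obtain ⟨c, hc⟩ := exists_embedding_e_e hq l j ha hi
      rw [hc, map_smul, AlgHom.toLinearMap_apply, torus_qdet_pow_mul, torus_chain, mul_smul_comm,
        smul_comm, ← zpow_natCast, ← zpow_mul, ← zpow_add]
      rw [Nat.sub_add_cancel ha, show ((l - p.1.1 : ℕ) : ℤ) - p.1.1 = l - 2 * p.1.1 by omega,
        show 2 * ((l : ℤ) - p.2.1) - l = l - 2 * p.2.1 by ring]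
    · have h1 := isHighest_left hq l j
      have h2 := isHighest_right hq l j
      rw [embedding, VVbar.homOfHighest_e_e hq _ _ ha hi]
      -- F̄^(i) of the highest weight vector is nonzero and still of highest weight for the first
      -- action, so F^(a) does not kill it either.
      have hc : ∀ g, Commute ((leftData q).toFun g) ((rightData q).fdiv p.2.1) := fun g =>
        (UData.fdiv_commute
          (show Commute (rightData q).F ((leftData q).toFun g) from
            (LinearMap.ext fun x => left_right_gen q g .F x : Commute _ _).symm) _).symm
      exact (h1.map (hc .E) (hc .F) (hc .K) (hc .I)).fdiv_ne_zero hq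
        (h2.fdiv_ne_zero (VVbar.inv_not_root hq) (qdet_pow_mul_B_pow_ne_zero q j l) hi) ha

/-- The image of v₀ ⊗ v̄₀ has the weights and degree of det_q^j B^l and is killed by E, hence is a
multiple of it; the images of the other basis vectors follow by divided powers. -/
theorem exists_eq_smul_embedding [CharZero 𝕜]
    (f : VVbar q l (l + 2 * j) →ₗ[Uq q ⊗[𝕜] Uq q⁻¹] GLqPlus q) :
    ∃ c : 𝕜, ∀ x, f x = c • embedding hq l j x := by
  set y := f (VVbar.tmul (Vrep.e q l _ 0) (Vrep.e q⁻¹ l _ 0)) with hy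
  have hE : (leftEData q).der y = 0 := by
    refine (VVbar.leftData_smul f .E _ _).trans ?_
    change f (VVbar.tmul (Vrep.opE _ _ _ _) _) = 0
    rw [Vrep.opE_e_zero, VVbar.zero_tmul, map_zero]
  have hK : torus q q 1 y = ((q ^ (l : ℤ) : 𝕜ˣ) : 𝕜) • y := by
    refine (VVbar.leftData_smul f .K _ _).trans ?_
    change f (VVbar.tmul (Vrep.opK _ _ _ _ _) _) = _
    rw [Vrep.opK_e, VVbar.smul_tmul, LinearMap.map_smul_of_tower]
    simp [hy]
  have hK' : torus q 1 q⁻¹ y = ((q⁻¹ ^ (l : ℤ) : 𝕜ˣ) : 𝕜) • y := by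
    refine (VVbar.rightData_smul f .K _ _).trans ?_
    change f (VVbar.tmul _ (Vrep.opK _ _ _ _ _)) = _
    rw [Vrep.opK_e, VVbar.tmul_smul_right, LinearMap.map_smul_of_tower]
    simp [hy]
  have hI : (degData q).der y = ((l + 2 * j : ℕ) : 𝕜) • y := by
    refine (VVbar.leftData_smul f .I _ _).trans ?_
    change f (VVbar.tmul ((((l : ℤ) + 2 * j : ℤ) : 𝕜) • _) _) = _
    rw [VVbar.smul_tmul, LinearMap.map_smul_of_tower]
    push_cast
    rfl
  obtain ⟨c, hc⟩ := exists_eq_smul_of_highestWeight hq hE hK hK' hI (leftE_highest l j)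
    ((torus_highest l j q 1).trans (by simp)) ((torus_highest l j 1 q⁻¹).trans (by simp))
    (deg_highest l j) (qdet_pow_mul_B_pow_ne_zero q j l)
  refine ⟨c, fun x => ?_⟩
  suffices f.restrictScalars 𝕜 = c • (embedding hq l j).restrictScalars 𝕜 from
    LinearMap.congr_fun this x
  refine (VVbar.basis q l _).ext fun p => ?_
  rw [VVbar.basis_apply, LinearMap.smul_apply, LinearMap.restrictScalars_apply,
    LinearMap.restrictScalars_apply, VVbar.hom_e_e hq, ← hy, hc, embedding,
    VVbar.homOfHighest_e_e hq _ _ (by omega) (by omega), map_smul, map_smul]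

/-- The inclusion of any subrepresentation isomorphic to V ⊗ V̄ is a multiple of `embedding` up to
the isomorphism, so it lies in the range. By injectivity the range is itself such a
subrepresentation. -/
theorem isotypicComponent_eq [CharZero 𝕜] :
    isotypicComponent (Uq q ⊗[𝕜] Uq q⁻¹) (GLqPlus q) (VVbar q l (l + 2 * j)) =
      LinearMap.range (embedding hq l j) := by
  refine le_antisymm (sSup_le ?_) (le_sSup ?_)
  · rintro m ⟨e⟩ x hx
    obtain ⟨c, hc⟩ := exists_eq_smul_embedding hq l j (m.subtype ∘ₗ e.symm.toLinearMap)
    have h := hc (e ⟨x, hx⟩)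
    simp only [LinearMap.comp_apply, LinearEquiv.coe_coe, LinearEquiv.symm_apply_apply,
      Submodule.subtype_apply] at h
    rw [h]
    exact ⟨c • e ⟨x, hx⟩, LinearMap.map_smul_of_tower _ _ _⟩
  · exact ⟨(LinearEquiv.ofInjective _ (embedding_injective hq l j)).symm⟩

/-- The isotypic component as the image of the embedding. -/
def componentEquiv [CharZero 𝕜] :
    VVbar q l (l + 2 * j) ≃ₗ[𝕜] component q l (l + 2 * j) :=
  (LinearEquiv.ofInjective ((embedding hq l j).restrictScalars 𝕜)
    (embedding_injective hq l j)).trans <| LinearEquiv.ofEq _ _ <| by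
      rw [component, isotypicComponent_eq hq]; rfl

theorem coe_componentEquiv [CharZero 𝕜] (x : VVbar q l (l + 2 * j)) :
    (componentEquiv hq l j x : GLqPlus q) = embedding hq l j x := rfl

end Component

-- The index set and the basis of elements Y

/-- The position of the index `r` when the indices are listed in decreasing order. -/
def Idx.equivFin (l : ℕ) : Idx l ≃ Fin (l + 1) where
  toFun r := ⟨(((l : ℤ) - r.1) / 2).toNat, by have := r.2; omega⟩
  invFun a := ⟨(l : ℤ) - 2 * a.1, by omega, by omega, by
    rw [Int.modEq_iff_dvd]; exact ⟨a.1, by ring⟩⟩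
  left_inv r := by
    obtain ⟨r, h1, h2, h3⟩ := r
    refine Subtype.ext ?_
    simp only [Int.ModEq] at h3 ⊢
    omega
  right_inv a := by
    refine Fin.ext ?_
    simp only
    omega

theorem Idx.eq_sub {l : ℕ} (r : Idx l) : r.1 = l - 2 * (Idx.equivFin l r).1 := by
  have h := congrArg Subtype.val ((Idx.equivFin l).symm_apply_apply r)
  exact h.symm

end

end QuantumGL

theorem proposition5p5 {𝕜 : Type*} [Field 𝕜] [CharZero 𝕜] (q h : 𝕜ˣ) (hh : h ^ 2 = q)
    (hq : ∀ n : ℕ, 0 < n → q ^ n ≠ 1) (l j : ℕ) :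
    Function.Injective (QuantumGL.GLqExt.incl q) ∧
      ∃ b : Module.Basis (QuantumGL.Idx l × QuantumGL.Idx l) 𝕜
          (QuantumGL.component q l (l + 2 * j)),
        ∀ p : QuantumGL.Idx l × QuantumGL.Idx l,
          QuantumGL.GLqExt.incl q (b p : QuantumGL.GLqPlus q) =
            QuantumGL.GLqExt.Y q h l j p.1 p.2 := by
  refine ⟨QuantumGL.GLqExt.incl_injective q h hh, ?_⟩
  -- For r = l - 2a the element Y has a rows (A, C), so a is the first tensor index. For k = l - 2m
  -- it is the coefficient of s^m, and m = l - i for the second tensor index i; hence the reversal.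
  let σ : QuantumGL.Idx l × QuantumGL.Idx l ≃ Fin (l + 1) × Fin (l + 1) :=
    (QuantumGL.Idx.equivFin l).prodCongr ((QuantumGL.Idx.equivFin l).trans Fin.revPerm)
  let B : Module.Basis (QuantumGL.Idx l × QuantumGL.Idx l) 𝕜
      (QuantumGL.component q l (l + 2 * j)) :=
    ((QuantumGL.VVbar.basis q l (l + 2 * j)).map
      (QuantumGL.componentEquiv hq l j)).reindex σ.symm
  have key : ∀ p, ∃ u : 𝕜ˣ, QuantumGL.GLqExt.Y q h l j p.1 p.2 =
      (u : 𝕜) • QuantumGL.GLqExt.incl q (B p : QuantumGL.GLqPlus q) := by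
    rintro ⟨r, k⟩
    have ha : (QuantumGL.Idx.equivFin l r).1 ≤ l := by omega
    have hk : (QuantumGL.Idx.equivFin l k).1 ≤ l := by omega
    obtain ⟨c, hc⟩ := QuantumGL.exists_embedding_e_e hq l j ha
      (Nat.sub_le l (QuantumGL.Idx.equivFin l k).1)
    obtain ⟨t, ht⟩ := QuantumGL.GLqExt.exists_Y_eq q h hh (l := l) j (r := r) (k := k)
      (b := l - (QuantumGL.Idx.equivFin l r).1) (a := (QuantumGL.Idx.equivFin l r).1)
      (m := (QuantumGL.Idx.equivFin l k).1) (by omega)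
      (by rw [QuantumGL.Idx.eq_sub r]; omega) (QuantumGL.Idx.eq_sub k)
    refine ⟨t * c⁻¹, ?_⟩
    have hB : (B (r, k) : QuantumGL.GLqPlus q) = (c : 𝕜) • (QuantumGL.GLqPlus.qdet q ^ j *
        QuantumGL.GLqPlus.chain q (l - (QuantumGL.Idx.equivFin l r).1)
          (QuantumGL.Idx.equivFin l r).1 (QuantumGL.Idx.equivFin l k).1) := by
      rw [show ((QuantumGL.Idx.equivFin l k).1 : ℤ) =
        l - (l - (QuantumGL.Idx.equivFin l k).1 : ℕ) by omega, ← hc]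
      simp only [B, Module.Basis.reindex_apply, Equiv.symm_symm, Module.Basis.map_apply,
        QuantumGL.coe_componentEquiv, QuantumGL.VVbar.basis_apply, σ]
      simp [Fin.val_rev]
    rw [ht, hB, map_smul, smul_smul, ← Units.val_mul, inv_mul_cancel_right]
  -- Rescaling a basis by units gives a basis, and these units turn its vectors into the elements Y.
  choose u hu using key
  refine ⟨B.unitsSMul u, fun p => ?_⟩
  rw [Module.Basis.unitsSMul_apply, hu p]
  exact map_smul (QuantumGL.GLqExt.incl q) (u p : 𝕜) (B p : QuantumGL.GLqPlus q)
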